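/- Let $0<p,q<\infty$. A weight is a non-negative, locally integrable function on $(0,\infty)$. For a weight $v$ and a measurable $f\ge 0$ put $\|f\|_{p,v}=\big(\int_0^\infty f^p v\big)^{1/p}$, and let $$(S_uf)(t)=\operatorname*{ess\,sup}_{0<\tau\le t}u(\tau)f(\tau),\qquad V_*(t)=\int_t^\infty v,\qquad W_*(t)=\int_t^\infty w .$$ There are constants $0<k\le K<\infty$ depending only on $p$ and $q$ such that the following holds for every continuous weight $u$ and all weights $v,w$ on $(0,\infty)$ with $0<V_*(x)<\infty$ and $0<W_*(x)<\infty$ for all $x>0$. Let $c\in[0,\infty]$ be the best constant in the inequality $$\|S_uf\|_{q,w}\le c\,\|f\|_{p,v}\qquad\text{for all non-decreasing } f:(0,\infty)\to[0,\infty],$$ with $c=\infty$ if the inequality holds with no finite constant. Put $$\Phi(t)=\sup_{0<\tau\le t}\frac{u(\tau)^p}{V_*(\tau)^2},\qquad E=\frac{\|S_u\mathbf 1\|_{q,w}}{\|\mathbf 1\|_{p,v}},$$ with the conventions $0\cdot\infty=0$ and $a/\infty=0$ for all $a\in[0,\infty]$, so that $E=0$ if $\|\mathbf 1\|_{p,v}=\infty$.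 (i) If $p\le q$, then $k\,(A_1+E)\le c\le K\,(A_1+E)$, where $$A_1=\sup_{x>0}\Big(\Phi(x)^{q/p}\,W_*(x)+\int_0^x\Phi(t)^{q/p}w(t)\,dt\Big)^{1/q}V_*(x)^{1/p}.$$ In particular the inequality holds with some finite constant if and only if $A_1+E<\infty$. (ii) If $q<p$ and $1/r=1/q-1/p$, then $k\,(B_1+B_2+E)\le c\le K\,(B_1+B_2+E)$, where $$B_1=\Big(\int_0^\infty\Big(\int_0^x\Phi(t)^{q/p}w(t)\,dt\Big)^{r/p}V_*(x)^{r/p}\,\Phi(x)^{q/p}\,w(x)\,dx\Big)^{1/r},$$ $$B_2=\Big(\int_0^\infty W_*(x)^{r/p}\Big[\sup_{0<t\le x}\Phi(t)\,V_*(t)\Big]^{r/p}w(x)\,dx\Big)^{1/r}.$$ In particular the inequality holds with some finite constant if and only if $B_1+B_2+E<\infty$. -/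

import Mathlib

open MeasureTheory Set
open scoped ENNReal NNReal

namespace SupremalHardy

/-- A weight on `(0,∞)`: a non-negative, locally integrable function on `(0,∞)`.
(Values outside `(0,∞)` are irrelevant everywhere below.) -/
structure IsWeight (v : ℝ → ℝ) : Prop where
  nonneg : ∀ t ∈ Ioi (0 : ℝ), 0 ≤ v t
  locallyIntegrable : LocallyIntegrableOn v (Ioi 0) volume

/-- `V_*(t) = ∫_t^∞ v`, with values in `[0,∞]`. -/
noncomputable def tail (v : ℝ → ℝ) (t : ℝ) : ℝ≥0∞ :=
  ∫⁻ s in Ioi t, ENNReal.ofReal (v s)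

/-- The functional `‖f‖_{p,v,(0,∞)} = (∫_0^∞ f^p v)^{1/p}` for `0 < p < ∞` and `f ≥ 0`. -/
noncomputable def wNorm (p : ℝ) (v : ℝ → ℝ) (f : ℝ → ℝ≥0∞) : ℝ≥0∞ :=
  (∫⁻ t in Ioi (0 : ℝ), f t ^ p * ENNReal.ofReal (v t)) ^ (1 / p)

/-- The supremal operator `(S g)(t) = ess sup_{0 < τ ≤ t} g(τ)`. -/
noncomputable def supOp (g : ℝ → ℝ≥0∞) (t : ℝ) : ℝ≥0∞ :=
  essSup g (volume.restrict (Ioc 0 t))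

/-- The weighted supremal operator `S_u f = S (f u)`. -/
noncomputable def supOpW (u : ℝ → ℝ) (f : ℝ → ℝ≥0∞) : ℝ → ℝ≥0∞ :=
  supOp (fun τ => f τ * ENNReal.ofReal (u τ))

/-- The inequality `‖S_u f‖_{q,w} ≤ c ‖f‖_{p,v}` for all non-decreasing `f : (0,∞) → [0,∞]`
(such functions are automatically measurable on `(0,∞)`). -/
def HoldsWith (p q : ℝ) (u v w : ℝ → ℝ) (c : ℝ≥0∞) : Prop :=
  ∀ f : ℝ → ℝ≥0∞, MonotoneOn f (Ioi 0) → wNorm q w (supOpW u f) ≤ c * wNorm p v f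

/-- The best (least) constant in the inequality; it is `∞` if no finite constant works. -/
noncomputable def bestConst (p q : ℝ) (u v w : ℝ → ℝ) : ℝ≥0∞ :=
  sInf {c | HoldsWith p q u v w c}

/-- `sup_{0 < τ ≤ t} u(τ)^p / V_*(τ)^2`. -/
noncomputable def supRatio (p : ℝ) (u v : ℝ → ℝ) (t : ℝ) : ℝ≥0∞ :=
  ⨆ τ ∈ Ioc (0 : ℝ) t, ENNReal.ofReal (u τ) ^ p / tail v τ ^ 2

/-- The test term `‖S_u 1‖_{q,w} / ‖1‖_{p,v}` (equal to `0` if `‖1‖_{p,v} = ∞`). -/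
noncomputable def testTerm (p q : ℝ) (u v w : ℝ → ℝ) : ℝ≥0∞ :=
  wNorm q w (supOpW u (fun _ => 1)) / wNorm p v (fun _ => 1)

/-- The exponent `r` with `1/r = 1/q - 1/p`, used for `0 < q < p`. -/
noncomputable def rExp (p q : ℝ) : ℝ := (1 / q - 1 / p)⁻¹

/-- The quantity `A₁` for the case `p ≤ q`. -/
noncomputable def A₁ (p q : ℝ) (u v w : ℝ → ℝ) : ℝ≥0∞ :=
  ⨆ x ∈ Ioi (0 : ℝ),
    (supRatio p u v x ^ (q / p) * tail w x
      + ∫⁻ t in Ioc (0 : ℝ) x, supRatio p u v t ^ (q / p) * ENNReal.ofReal (w t)) ^ (1 / q)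
      * tail v x ^ (1 / p)

/-- The quantity `B₁` for the case `q < p`. -/
noncomputable def B₁ (p q : ℝ) (u v w : ℝ → ℝ) : ℝ≥0∞ :=
  (∫⁻ x in Ioi (0 : ℝ),
    (∫⁻ t in Ioc (0 : ℝ) x,
        supRatio p u v t ^ (q / p) * ENNReal.ofReal (w t)) ^ (rExp p q / p)
      * tail v x ^ (rExp p q / p) * supRatio p u v x ^ (q / p)
      * ENNReal.ofReal (w x)) ^ (1 / rExp p q)

/-- The quantity `B₂` for the case `q < p`. -/
noncomputable def B₂ (p q : ℝ) (u v w : ℝ → ℝ) : ℝ≥0∞ :=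
  (∫⁻ x in Ioi (0 : ℝ),
    tail w x ^ (rExp p q / p)
      * (⨆ t ∈ Ioc (0 : ℝ) x, supRatio p u v t * tail v t) ^ (rExp p q / p)
      * ENNReal.ofReal (w x)) ^ (1 / rExp p q)

end SupremalHardy

open SupremalHardy

namespace SupremalHardy

/-- A family of rays pointing in a common direction, such as all `Iic x` or all `Ici x`. -/
structure IsRayFamily (τ : ℝ → Set ℝ) : Prop where
  self_mem : ∀ x, x ∈ τ x
  subset_of_mem : ∀ {x t}, t ∈ τ x → τ t ⊆ τ x
  total : ∀ x t, t ∈ τ x ∨ x ∈ τ t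
  measurableSet : ∀ x, MeasurableSet (τ x)
  exists_countable_cover : ∀ T : Set ℝ, (∀ x ∈ T, τ x ⊆ T) →
    ∃ D : Set ℝ, D.Countable ∧ D ⊆ T ∧ T = ⋃ x ∈ D, τ x

theorem isRayFamily_Iic : IsRayFamily Iic where
  self_mem x := self_mem_Iic
  subset_of_mem h := Iic_subset_Iic.2 h
  total x t := le_total t x
  measurableSet x := measurableSet_Iic
  exists_countable_cover T hT := by
    by_cases h : ∃ z ∈ T, ∀ x ∈ T, x ≤ z
    · obtain ⟨z, hz, hmax⟩ := h
      refine ⟨{z}, countable_singleton z, singleton_subset_iff.2 hz, ?_⟩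
      rw [biUnion_singleton]
      exact Subset.antisymm hmax (hT z hz)
    · push Not at h
      refine ⟨T ∩ range ((↑) : ℚ → ℝ), (countable_range _).mono inter_subset_right,
        inter_subset_left, Subset.antisymm (fun x hx => ?_)
          (iUnion₂_subset fun x hx => hT x hx.1)⟩
      obtain ⟨y, hy, hxy⟩ := h x hx
      obtain ⟨r, hr, hr'⟩ := exists_rat_btwn hxy
      exact mem_iUnion₂.2 ⟨r, ⟨hT y hy hr'.le, r, rfl⟩, hr.le⟩

theorem isRayFamily_Ici : IsRayFamily Ici where
  self_mem x := self_mem_Ici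
  subset_of_mem h := Ici_subset_Ici.2 h
  total x t := le_total x t
  measurableSet x := measurableSet_Ici
  exists_countable_cover T hT := by
    by_cases h : ∃ z ∈ T, ∀ x ∈ T, z ≤ x
    · obtain ⟨z, hz, hmin⟩ := h
      refine ⟨{z}, countable_singleton z, singleton_subset_iff.2 hz, ?_⟩
      rw [biUnion_singleton]
      exact Subset.antisymm hmin (hT z hz)
    · push Not at h
      refine ⟨T ∩ range ((↑) : ℚ → ℝ), (countable_range _).mono inter_subset_right,
        inter_subset_left, Subset.antisymm (fun x hx => ?_)
          (iUnion₂_subset fun x hx => hT x hx.1)⟩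
      obtain ⟨y, hy, hxy⟩ := h x hx
      obtain ⟨r, hr, hr'⟩ := exists_rat_btwn hxy
      exact mem_iUnion₂.2 ⟨r, ⟨hT y hy hr.le, r, rfl⟩, hr'.le⟩

namespace IsRayFamily

variable {τ : ℝ → Set ℝ}

theorem measurableSet_of_closed (hτ : IsRayFamily τ) {T : Set ℝ} (hT : ∀ x ∈ T, τ x ⊆ T) :
    MeasurableSet T := by
  obtain ⟨D, hD, -, rfl⟩ := hτ.exists_countable_cover T hT
  exact .biUnion hD fun x _ => hτ.measurableSet x

theorem measure_eq_iSup (hτ : IsRayFamily τ) (ν : Measure ℝ) {T : Set ℝ}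
    (hT : ∀ x ∈ T, τ x ⊆ T) : ν T = ⨆ x ∈ T, ν (τ x) := by
  obtain ⟨D, hD, hDT, h⟩ := hτ.exists_countable_cover T hT
  refine le_antisymm ?_ (iSup₂_le fun x hx => measure_mono (hT x hx))
  conv_lhs => rw [h]
  rw [measure_biUnion_eq_iSup hD]
  · exact iSup₂_le fun x hx => le_iSup₂_of_le x (hDT hx) le_rfl
  · intro x hx y hy
    rcases hτ.total x y with h | h
    · exact ⟨x, hx, subset_rfl, hτ.subset_of_mem h⟩
    · exact ⟨y, hy, hτ.subset_of_mem h, subset_rfl⟩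

theorem measurable_measure (hτ : IsRayFamily τ) (ν : Measure ℝ) :
    Measurable fun x => ν (τ x) := by
  refine measurable_of_Ioi fun c => ?_
  have : (fun x => ν (τ x)) ⁻¹' Ioi c = {x | ν (τ x) ≤ c}ᶜ := by
    ext x; simp
  rw [this]
  exact (hτ.measurableSet_of_closed fun x hx t ht =>
    (measure_mono (hτ.subset_of_mem ht)).trans hx).compl

theorem measure_univ_rpow_le (hτ : IsRayFamily τ) (ν : Measure ℝ) {β : ℝ} (hβ : 0 ≤ β) :
    ν univ ^ (β + 1) ≤ 2 ^ (β + 1) * ∫⁻ x, ν (τ x) ^ β ∂ν := by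
  have key : ∀ c : ℝ≥0∞, c ^ β * (ν univ - c) ≤ ∫⁻ x, ν (τ x) ^ β ∂ν := by
    intro c
    set T : Set ℝ := {x | ν (τ x) < c} with hTdef
    have hT : ∀ x ∈ T, τ x ⊆ T := fun x hx t ht =>
      (measure_mono (hτ.subset_of_mem ht)).trans_lt hx
    have h1 : ν T ≤ c := by
      rw [hτ.measure_eq_iSup ν hT]
      exact iSup₂_le fun x hx => le_of_lt hx
    have hm := hτ.measurableSet_of_closed hT
    have h2 : ν univ - c ≤ ν Tᶜ := by
      rw [tsub_le_iff_left, ← measure_add_measure_compl hm]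
      gcongr
    calc c ^ β * (ν univ - c) ≤ c ^ β * ν Tᶜ := by gcongr
      _ = ∫⁻ x in Tᶜ, c ^ β ∂ν := by rw [setLIntegral_const]
      _ ≤ ∫⁻ x in Tᶜ, ν (τ x) ^ β ∂ν := setLIntegral_mono' hm.compl fun x hx => by
          have : c ≤ ν (τ x) := by simpa [T] using hx
          gcongr
      _ ≤ _ := setLIntegral_le_lintegral _ _
  by_cases h : ν univ = ∞
  · have := key 1
    rw [h, ENNReal.one_rpow, one_mul, ENNReal.top_sub ENNReal.one_ne_top, top_le_iff] at this
    rw [this, ENNReal.mul_top (by positivity)]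
    exact le_top
  · have h2 := key (ν univ / 2)
    rw [ENNReal.sub_half h] at h2
    calc ν univ ^ (β + 1) = (2 * (ν univ / 2)) ^ (β + 1) := by
          rw [ENNReal.mul_div_cancel (by simp) (by simp)]
      _ = 2 ^ (β + 1) * ((ν univ / 2) ^ β * (ν univ / 2)) := by
          rw [ENNReal.mul_rpow_of_nonneg _ _ (by positivity),
            ENNReal.rpow_add_of_nonneg (x := ν univ / 2) _ _ hβ zero_le_one, ENNReal.rpow_one]
      _ ≤ _ := by gcongr

theorem measure_rpow_le (hτ : IsRayFamily τ) (ν : Measure ℝ) {β : ℝ} (hβ : 0 ≤ β) (T : Set ℝ) :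
    ν T ^ (β + 1) ≤ 2 ^ (β + 1) * ∫⁻ x in T, ν (τ x) ^ β ∂ν := by
  have := hτ.measure_univ_rpow_le (ν.restrict T) hβ
  rw [Measure.restrict_apply_univ] at this
  refine this.trans ?_
  gcongr with x
  exact Measure.restrict_le_self

end IsRayFamily

theorem exists_two_rpow_lt_le {y : ℝ≥0∞} (h0 : y ≠ 0) (h1 : y ≠ ∞) :
    ∃ n : ℤ, (2 : ℝ≥0∞) ^ (n : ℝ) < y ∧ y ≤ 2 * 2 ^ (n : ℝ) := by
  obtain ⟨n, hn, hn'⟩ := ENNReal.exists_mem_Ioc_zpow h0 h1 ENNReal.one_lt_two ENNReal.ofNat_ne_top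
  refine ⟨n, by rwa [ENNReal.rpow_intCast], hn'.trans_eq ?_⟩
  rw [ENNReal.rpow_intCast, ENNReal.zpow_add (by simp) (by simp), zpow_one, mul_comm]

theorem two_rpow_ne_zero (a : ℝ) : (2 : ℝ≥0∞) ^ a ≠ 0 := by simp

theorem two_rpow_ne_top (a : ℝ) : (2 : ℝ≥0∞) ^ a ≠ ∞ := by simp

theorem two_rpow_add (a b : ℝ) : (2 : ℝ≥0∞) ^ (a + b) = 2 ^ a * 2 ^ b :=
  ENNReal.rpow_add a b (by simp) (by simp)

theorem two_rpow_lt_iff {a b : ℝ} : (2 : ℝ≥0∞) ^ a < 2 ^ b ↔ a < b :=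
  (show StrictMono fun a : ℝ => (2 : ℝ≥0∞) ^ a from fun _ _ h =>
    ENNReal.rpow_lt_rpow_of_exponent_lt ENNReal.one_lt_two (by simp) h).lt_iff_lt

/-- The constant of the one-sided dyadic geometric series. -/
noncomputable def geomConst (β : ℝ) : ℝ≥0∞ := (1 - 2 ^ (-β))⁻¹

theorem geomConst_ne_top {β : ℝ} (hβ : 0 < β) : geomConst β ≠ ∞ := by
  unfold geomConst
  have : (2 : ℝ≥0∞) ^ (-β) < 1 := ENNReal.rpow_lt_one_of_one_lt_of_neg ENNReal.one_lt_two (by linarith)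
  simpa [tsub_eq_zero_iff_le] using this

theorem geomConst_ne_zero (β : ℝ) : geomConst β ≠ 0 := by
  unfold geomConst
  exact ENNReal.inv_ne_zero.2 (ne_top_of_le_ne_top ENNReal.one_ne_top tsub_le_self)

theorem tsum_two_rpow_le {β : ℝ} (hβ : 0 < β) (y : ℝ≥0∞) :
    ∑' m : ℤ, (if (2 : ℝ≥0∞) ^ (m : ℝ) < y then (2 : ℝ≥0∞) ^ (m * β) else 0)
      ≤ geomConst β * y ^ β := by
  by_cases h0 : y = 0
  · simp [h0]
  by_cases h1 : y = ∞
  · rw [h1, ENNReal.top_rpow_of_pos hβ, ENNReal.mul_top (geomConst_ne_zero β)]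
    exact le_top
  obtain ⟨n, hn, hn'⟩ := exists_two_rpow_lt_le h0 h1
  have hinj : Function.Injective fun k : ℕ => n - (k : ℤ) := fun a b h => by
    simpa using h
  rw [← hinj.tsum_eq]
  · calc ∑' k : ℕ, (if (2 : ℝ≥0∞) ^ ((n - (k : ℤ) : ℤ) : ℝ) < y
            then (2 : ℝ≥0∞) ^ (((n - (k : ℤ) : ℤ) : ℝ) * β) else 0)
        ≤ ∑' k : ℕ, 2 ^ ((n : ℝ) * β) * ((2 : ℝ≥0∞) ^ (-β)) ^ k := by
          refine ENNReal.tsum_le_tsum fun k => ?_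
          split_ifs
          · rw [← ENNReal.rpow_natCast, ← ENNReal.rpow_mul, ← two_rpow_add]
            refine le_of_eq ?_
            congr 1
            push_cast
            ring
          · exact bot_le
      _ = geomConst β * (2 ^ (n : ℝ)) ^ β := by
          rw [ENNReal.tsum_mul_left, ENNReal.tsum_geometric, ENNReal.rpow_mul, mul_comm, geomConst]
      _ ≤ _ := by gcongr
  · intro m hm
    have hm : (2 : ℝ≥0∞) ^ (m : ℝ) < y := by
      by_contra h
      exact hm (if_neg h)
    have h3 : (2 : ℝ≥0∞) ^ (m : ℝ) < 2 ^ (1 + n : ℝ) := by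
      rw [two_rpow_add, ENNReal.rpow_one]
      exact hm.trans_le hn'
    rw [two_rpow_lt_iff] at h3
    have h4 : m < 1 + n := by exact_mod_cast h3
    exact ⟨(n - m).toNat, by simp only; omega⟩

theorem rpow_le_tsum_two_rpow {β : ℝ} (hβ : 0 < β) (y : ℝ≥0∞) :
    y ^ β ≤ ∑' m : ℤ, (if (2 : ℝ≥0∞) ^ (m : ℝ) < y then (2 : ℝ≥0∞) ^ β * 2 ^ (m * β) else 0) := by
  have key : ∀ z : ℝ≥0∞, z ≠ ∞ → z ≤ y → z ^ β ≤
      ∑' m : ℤ, (if (2 : ℝ≥0∞) ^ (m : ℝ) < y then (2 : ℝ≥0∞) ^ β * 2 ^ (m * β) else 0) := by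
    intro z hz hzy
    by_cases h0 : z = 0
    · simp [h0, hβ]
    obtain ⟨n, hn, hn'⟩ := exists_two_rpow_lt_le h0 hz
    refine le_trans ?_ (ENNReal.le_tsum n)
    rw [if_pos (hn.trans_le hzy), ENNReal.rpow_mul, ← ENNReal.mul_rpow_of_nonneg _ _ hβ.le]
    gcongr
  by_cases h1 : y = ∞
  · rw [h1, ENNReal.top_rpow_of_pos hβ, ← h1]
    refine le_of_forall_lt fun c hc => ?_
    rw [h1] at hc
    have hc1 : c + 1 ≠ ∞ := by simp [hc.ne]
    have := key ((c + 1) ^ β⁻¹) (ENNReal.rpow_ne_top_of_nonneg (by positivity) hc1) (h1 ▸ le_top)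
    rw [← ENNReal.rpow_mul, inv_mul_cancel₀ hβ.ne', ENNReal.rpow_one] at this
    exact (ENNReal.lt_add_right hc.ne one_ne_zero).trans_le this
  · exact key y h1 le_rfl

theorem tsum_rpow_mul_le {α : ℝ} (h0 : 0 < α) (h1 : α < 1) (x y : ℤ → ℝ≥0∞) :
    ∑' k, x k ^ α * y k ≤ (∑' k, x k) ^ α * (∑' k, y k ^ (1 - α)⁻¹) ^ (1 - α) := by
  have hc : (α⁻¹).HolderConjugate (1 - α)⁻¹ := by
    rw [Real.holderConjugate_iff]
    exact ⟨(one_lt_inv₀ h0).2 h1, by simp⟩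
  have := ENNReal.lintegral_mul_le_Lp_mul_Lq (Measure.count : Measure ℤ) hc
    (f := fun k => x k ^ α) (g := y) (Measurable.of_discrete.aemeasurable)
    (Measurable.of_discrete.aemeasurable)
  simp only [lintegral_count, Pi.mul_apply, one_div, inv_inv, ← ENNReal.rpow_mul,
    mul_inv_cancel₀ h0.ne', ENNReal.rpow_one] at this
  exact this

theorem tsum_rpow_le {α : ℝ} (h1 : 1 ≤ α) (x : ℤ → ℝ≥0∞) :
    ∑' k, x k ^ α ≤ (∑' k, x k) ^ α := by
  have h : ∀ z : ℝ≥0∞, z ^ α = z * z ^ (α - 1) := fun z => by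
    conv_lhs => rw [← add_sub_cancel 1 α]
    rw [ENNReal.rpow_add_of_nonneg _ _ zero_le_one (by linarith), ENNReal.rpow_one]
  rw [h, ← ENNReal.tsum_mul_right]
  refine ENNReal.tsum_le_tsum fun k => ?_
  rw [h]
  have : 0 ≤ α - 1 := by linarith
  gcongr
  exact ENNReal.le_tsum k

theorem le_of_le_mul_rpow {α β : ℝ} (hα0 : 0 < α) (hα1 : α < 1) (hβ : β * (1 - α) = α)
    {Z A : ℝ≥0∞} (hZ : Z ≠ ∞) (h : Z ≤ A * Z ^ α) : Z ≤ A ^ (β + 1) := by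
  by_cases h0 : Z = 0
  · simp [h0]
  have hθ : (1 - α) * (β + 1) = 1 := by linarith
  have hθ0 : 0 ≤ β + 1 := by
    have : 0 < 1 - α := by linarith
    nlinarith
  have h2 : Z ^ (1 - α) ≤ A := by
    rw [ENNReal.rpow_sub _ _ h0 hZ, ENNReal.rpow_one]
    exact ENNReal.div_le_of_le_mul h
  calc Z = (Z ^ (1 - α)) ^ (β + 1) := by rw [← ENNReal.rpow_mul, hθ, ENNReal.rpow_one]
    _ ≤ _ := by gcongr

theorem sum_two_rpow_indicator_le {τ : ℝ → Set ℝ} (hτ : IsRayFamily τ) (ν : Measure ℝ) {β : ℝ}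
    (hβ : 0 < β) (M : Finset ℤ) (x : ℤ → ℝ) (t : ℝ) :
    ∑ m ∈ M, (τ (x m)).indicator (fun t => (2 : ℝ≥0∞) ^ (m * β) * ν (τ t) ^ β) t ≤
      geomConst β * 2 ^ β *
        ⨆ m ∈ M, (τ (x m)).indicator (fun _ => (2 : ℝ≥0∞) ^ (m * β) * ν (τ (x m)) ^ β) t := by
  classical
  simp only [indicator_apply]
  rw [← Finset.sum_filter]
  rcases (M.filter fun m => t ∈ τ (x m)).eq_empty_or_nonempty with h | h
  · simp [h]
  obtain ⟨n, hn, hmax⟩ := Finset.exists_max_image _ id h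
  rw [Finset.mem_filter] at hn
  calc ∑ m ∈ M.filter fun m => t ∈ τ (x m), (2 : ℝ≥0∞) ^ (m * β) * ν (τ t) ^ β
      = (∑ m ∈ M.filter fun m => t ∈ τ (x m),
          if (2 : ℝ≥0∞) ^ (m : ℝ) < 2 ^ (1 + n : ℝ) then (2 : ℝ≥0∞) ^ (m * β) else 0)
          * ν (τ t) ^ β := by
        rw [Finset.sum_mul]
        refine Finset.sum_congr rfl fun m hm => ?_
        have : m ≤ n := hmax m hm
        have : (m : ℝ) ≤ n := by exact_mod_cast this
        rw [if_pos (two_rpow_lt_iff.2 (by linarith))]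
    _ ≤ (geomConst β * (2 ^ (1 + n : ℝ)) ^ β) * ν (τ t) ^ β := by
        gcongr
        exact (ENNReal.sum_le_tsum _).trans (tsum_two_rpow_le hβ _)
    _ = geomConst β * 2 ^ β * (2 ^ (n * β) * ν (τ t) ^ β) := by
        rw [← ENNReal.rpow_mul, add_mul, two_rpow_add, one_mul]
        ring
    _ ≤ _ := by
        gcongr
        refine le_iSup₂_of_le n hn.1 ?_
        rw [if_pos hn.2]
        gcongr
        exact hτ.subset_of_mem hn.2

/-- The constant in the discrete estimate behind the necessity of the integral conditions. -/
noncomputable def lowerConst (β : ℝ) : ℝ≥0∞ := 2 ^ (β + 1) * (geomConst β * 2 ^ β)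

theorem sum_rpow_measure_ray_le {τ : ℝ → Set ℝ} (hτ : IsRayFamily τ) (ν : Measure ℝ) {α β : ℝ}
    (hα0 : 0 < α) (hα1 : α < 1) (hβ0 : 0 < β) (hβ : β * (1 - α) = α) {D : ℝ≥0∞} (hD : D ≠ ∞)
    (M : Finset ℤ) (x : ℤ → ℝ)
    (H : ∀ (N : Finset ℤ) (η : ℤ → ℝ≥0∞), N ⊆ M → (∀ m ∈ N, η m ≠ ∞) →
      ∫⁻ t, ⨆ m ∈ N, (τ (x m)).indicator (fun _ => ((2 : ℝ≥0∞) ^ (m : ℝ) * η m) ^ α) t ∂ν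
        ≤ D * (∑ m ∈ N, η m) ^ α) :
    ∑ m ∈ M, (2 : ℝ≥0∞) ^ (m * β) * ν (τ (x m)) ^ (β + 1) ≤ (lowerConst β * D) ^ (β + 1) := by
  have hfin : ∀ m ∈ M, ν (τ (x m)) ≠ ∞ := by
    intro m hm
    have := H {m} 1 (by simpa using hm) (by simp)
    simp only [Finset.mem_singleton, iSup_iSup_eq_left, Pi.one_apply, mul_one,
      Finset.sum_singleton, ENNReal.one_rpow] at this
    rw [lintegral_indicator (hτ.measurableSet _), setLIntegral_const] at this
    intro htop
    rw [htop, ENNReal.mul_top (by rw [← ENNReal.rpow_mul]; exact two_rpow_ne_zero _), top_le_iff] at this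
    exact hD this
  set η : ℤ → ℝ≥0∞ := fun m => (2 : ℝ≥0∞) ^ (m * β) * ν (τ (x m)) ^ (β + 1) with hη
  have hηfin : ∀ m ∈ M, η m ≠ ∞ := fun m hm =>
    ENNReal.mul_ne_top (by simp) (ENNReal.rpow_ne_top_of_nonneg (by positivity) (hfin m hm))
  refine le_of_le_mul_rpow hα0 hα1 hβ (ENNReal.sum_ne_top.2 hηfin) ?_
  have hmeas := hτ.measurable_measure ν
  have hmeas' : ∀ c : ℝ≥0∞, Measurable fun t => c * ν (τ t) ^ β := fun c =>
    (hmeas.pow_const β).const_mul c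
  have e : ∀ m : ℤ, ((2 : ℝ≥0∞) ^ (m : ℝ) * η m) ^ α = 2 ^ (m * β) * ν (τ (x m)) ^ β := by
    intro m
    simp only [hη]
    rw [ENNReal.mul_rpow_of_nonneg _ _ hα0.le, ENNReal.mul_rpow_of_nonneg _ _ hα0.le,
      ← ENNReal.rpow_mul, ← ENNReal.rpow_mul, ← ENNReal.rpow_mul, ← mul_assoc, ← two_rpow_add]
    have e1 : (β + 1) * α = β := by linarith
    have e2 : (m : ℝ) * α + m * β * α = m * β := by linear_combination (m : ℝ) * e1
    rw [e1, e2]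
  calc ∑ m ∈ M, η m
      ≤ ∑ m ∈ M, (2 : ℝ≥0∞) ^ (m * β) * (2 ^ (β + 1) * ∫⁻ t in τ (x m), ν (τ t) ^ β ∂ν) := by
        refine Finset.sum_le_sum fun m _ => ?_
        simp only [hη]
        gcongr
        exact hτ.measure_rpow_le ν hβ0.le _
    _ = 2 ^ (β + 1) * ∫⁻ t, ∑ m ∈ M,
          (τ (x m)).indicator (fun t => (2 : ℝ≥0∞) ^ (m * β) * ν (τ t) ^ β) t ∂ν := by
        rw [lintegral_finsetSum _ fun m _ =>
          (hmeas' _).indicator (hτ.measurableSet _), Finset.mul_sum]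
        refine Finset.sum_congr rfl fun m _ => ?_
        rw [lintegral_indicator (hτ.measurableSet _), lintegral_const_mul _ (hmeas.pow_const β)]
        ring
    _ ≤ 2 ^ (β + 1) * ∫⁻ t, geomConst β * 2 ^ β *
        ⨆ m ∈ M, (τ (x m)).indicator (fun _ => (2 : ℝ≥0∞) ^ (m * β) * ν (τ (x m)) ^ β) t ∂ν := by
        gcongr with t
        exact sum_two_rpow_indicator_le hτ ν hβ0 M x t
    _ = lowerConst β *
        ∫⁻ t, ⨆ m ∈ M, (τ (x m)).indicator (fun _ => ((2 : ℝ≥0∞) ^ (m : ℝ) * η m) ^ α) t ∂ν := by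
        rw [lintegral_const_mul', lowerConst]
        · simp only [e]
          ring
        · exact ENNReal.mul_ne_top (geomConst_ne_top hβ0) (by simp)
    _ ≤ lowerConst β * (D * (∑ m ∈ M, η m) ^ α) := by
        gcongr
        exact H M η subset_rfl hηfin
    _ = _ := by ring

theorem lintegral_measure_ray_rpow_le {τ : ℝ → Set ℝ} (hτ : IsRayFamily τ) (ν : Measure ℝ)
    {α β : ℝ} (hα0 : 0 < α) (hα1 : α < 1) (hβ0 : 0 < β) (hβ : β * (1 - α) = α) {G : ℝ → ℝ≥0∞}
    (hG : ∀ x, ∀ t ∈ τ x, G x ≤ G t) {D : ℝ≥0∞} (hD : D ≠ ∞)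
    (H : ∀ (N : Finset ℤ) (x : ℤ → ℝ) (η : ℤ → ℝ≥0∞),
      (∀ m ∈ N, (2 : ℝ≥0∞) ^ (m : ℝ) < G (x m)) → (∀ m ∈ N, η m ≠ ∞) →
      ∫⁻ t, ⨆ m ∈ N, (τ (x m)).indicator (fun _ => ((2 : ℝ≥0∞) ^ (m : ℝ) * η m) ^ α) t ∂ν
        ≤ D * (∑ m ∈ N, η m) ^ α) :
    ∫⁻ t, ν (τ t) ^ β * G t ^ β ∂ν ≤ 2 ^ β * (lowerConst β * D) ^ (β + 1) := by
  classical
  set T : ℤ → Set ℝ := fun m => {x | (2 : ℝ≥0∞) ^ (m : ℝ) < G x} with hTdef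
  have hT : ∀ m, ∀ x ∈ T m, τ x ⊆ T m := fun m x hx t ht => lt_of_lt_of_le hx (hG x t ht)
  have hTm := fun m => hτ.measurableSet_of_closed (hT m)
  have hmeas := hτ.measurable_measure ν
  have hmeas' : ∀ c : ℝ≥0∞, Measurable fun t => c * ν (τ t) ^ β := fun c =>
    (hmeas.pow_const β).const_mul c
  have key : ∀ M : Finset ℤ, ∑ m ∈ M, (2 : ℝ≥0∞) ^ (m * β) * ν (T m) ^ (β + 1) ≤
      (lowerConst β * D) ^ (β + 1) := by
    intro M
    have hseq : ∀ m, (T m).Nonempty → ∃ y : ℕ → ℝ, (∀ n, y n ∈ T m) ∧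
        Filter.Tendsto (fun n => ν (τ (y n))) Filter.atTop (nhds (ν (T m))) := by
      intro m hm
      obtain ⟨u, -, hu, hmem⟩ := exists_seq_tendsto_sSup (S := (fun x => ν (τ x)) '' T m)
        (hm.image _) (OrderTop.bddAbove _)
      choose y hy hy' using hmem
      refine ⟨y, hy, ?_⟩
      rw [hτ.measure_eq_iSup ν (hT m), ← sSup_image]
      exact hu.congr fun n => (hy' n).symm
    have hex : ∀ m, ∃ y : ℕ → ℝ, (T m).Nonempty → (∀ n, y n ∈ T m) ∧
        Filter.Tendsto (fun n => ν (τ (y n))) Filter.atTop (nhds (ν (T m))) := fun m => by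
      by_cases h : (T m).Nonempty
      · obtain ⟨y, hy⟩ := hseq m h
        exact ⟨y, fun _ => hy⟩
      · exact ⟨0, fun h' => (h h').elim⟩
    choose y hy using hex
    have hfil : ∑ m ∈ M, (2 : ℝ≥0∞) ^ (m * β) * ν (T m) ^ (β + 1) =
        ∑ m ∈ M.filter fun m => (T m).Nonempty, (2 : ℝ≥0∞) ^ (m * β) * ν (T m) ^ (β + 1) := by
      refine (Finset.sum_filter_of_ne fun m _ hne => ?_).symm
      by_contra hemp
      rw [not_nonempty_iff_eq_empty] at hemp
      rw [hemp, measure_empty, ENNReal.zero_rpow_of_pos (by linarith), mul_zero] at hne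
      exact hne rfl
    rw [hfil]
    have hlim : Filter.Tendsto (fun n => ∑ m ∈ M.filter fun m => (T m).Nonempty,
        (2 : ℝ≥0∞) ^ (m * β) * ν (τ (y m n)) ^ (β + 1)) Filter.atTop
        (nhds (∑ m ∈ M.filter fun m => (T m).Nonempty,
          (2 : ℝ≥0∞) ^ (m * β) * ν (T m) ^ (β + 1))) := by
      refine tendsto_finsetSum _ fun m hm => ?_
      refine ENNReal.Tendsto.const_mul ?_ (Or.inr (by simp))
      exact (ENNReal.continuous_rpow_const.tendsto _).comp (hy m (Finset.mem_filter.1 hm).2).2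
    refine le_of_tendsto' hlim fun n => ?_
    refine sum_rpow_measure_ray_le hτ ν hα0 hα1 hβ0 hβ hD _ (fun m => y m n) fun N η hN hη => ?_
    exact H N _ η (fun m hm => (hy m (Finset.mem_filter.1 (hN hm)).2).1 n) hη
  have hpt : ∀ t, ν (τ t) ^ β * G t ^ β ≤ ∑' m : ℤ, (T m).indicator
      (fun t => 2 ^ β * (2 : ℝ≥0∞) ^ (m * β) * ν (τ t) ^ β) t := by
    intro t
    calc ν (τ t) ^ β * G t ^ β ≤ ν (τ t) ^ β * ∑' m : ℤ,
          (if (2 : ℝ≥0∞) ^ (m : ℝ) < G t then (2 : ℝ≥0∞) ^ β * 2 ^ (m * β) else 0) := by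
          gcongr
          exact rpow_le_tsum_two_rpow hβ0 _
      _ = _ := by
          rw [← ENNReal.tsum_mul_left]
          refine tsum_congr fun m => ?_
          simp only [indicator_apply, T, mem_ofPred_eq]
          split_ifs <;> ring
  calc ∫⁻ t, ν (τ t) ^ β * G t ^ β ∂ν
      ≤ ∫⁻ t, ∑' m : ℤ, (T m).indicator
        (fun t => 2 ^ β * (2 : ℝ≥0∞) ^ (m * β) * ν (τ t) ^ β) t ∂ν := lintegral_mono hpt
    _ = ∑' m : ℤ, 2 ^ β * (2 : ℝ≥0∞) ^ (m * β) * ∫⁻ t in T m, ν (τ t) ^ β ∂ν := by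
        rw [lintegral_tsum fun m =>
          ((hmeas' _).indicator (hTm m)).aemeasurable]
        refine tsum_congr fun m => ?_
        rw [lintegral_indicator (hTm m), lintegral_const_mul _ (hmeas.pow_const β)]
    _ ≤ ∑' m : ℤ, 2 ^ β * ((2 : ℝ≥0∞) ^ (m * β) * ν (T m) ^ (β + 1)) := by
        refine ENNReal.tsum_le_tsum fun m => ?_
        rw [mul_assoc]
        gcongr
        calc ∫⁻ t in T m, ν (τ t) ^ β ∂ν ≤ ∫⁻ t in T m, ν (T m) ^ β ∂ν :=
              setLIntegral_mono' (hTm m) fun t ht => by gcongr; exact hT m t ht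
          _ = ν (T m) ^ (β + 1) := by
              rw [setLIntegral_const, ENNReal.rpow_add_of_nonneg _ _ hβ0.le zero_le_one,
                ENNReal.rpow_one]
    _ ≤ _ := by
        rw [ENNReal.tsum_mul_left]
        gcongr
        rw [ENNReal.tsum_eq_iSup_sum]
        exact iSup_le key

theorem dyadic_unique {y : ℝ≥0∞} {m n : ℤ} (hm : (2 : ℝ≥0∞) ^ (m : ℝ) < y)
    (hm' : y ≤ 2 * 2 ^ (m : ℝ)) (hn : (2 : ℝ≥0∞) ^ (n : ℝ) < y) (hn' : y ≤ 2 * 2 ^ (n : ℝ)) :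
    m = n := by
  have h : ∀ k : ℤ, (2 : ℝ≥0∞) * 2 ^ (k : ℝ) = 2 ^ (1 + k : ℝ) := fun k => by
    rw [two_rpow_add, ENNReal.rpow_one]
  rw [h] at hm' hn'
  have h1 := two_rpow_lt_iff.1 (hm.trans_le hn')
  have h2 := two_rpow_lt_iff.1 (hn.trans_le hm')
  have h1' : m < 1 + n := by exact_mod_cast h1
  have h2' : n < 1 + m := by exact_mod_cast h2
  omega

theorem tsum_dyadic_le (y c : ℝ≥0∞) :
    ∑' l : ℤ, (if (2 : ℝ≥0∞) ^ (l : ℝ) < y ∧ y ≤ 2 * 2 ^ (l : ℝ) then c else 0) ≤ c := by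
  by_cases h : ∃ n : ℤ, (2 : ℝ≥0∞) ^ (n : ℝ) < y ∧ y ≤ 2 * 2 ^ (n : ℝ)
  · obtain ⟨n, hn, hn'⟩ := h
    rw [tsum_eq_single n fun l hl => if_neg fun h => hl (dyadic_unique h.1 h.2 hn hn'),
      if_pos ⟨hn, hn'⟩]
  · push Not at h
    rw [ENNReal.tsum_eq_zero.2 fun l => if_neg fun h' => (h l h'.1).not_ge h'.2]
    exact bot_le

theorem iSup₂_rpow {ι : Type*} (s : Set ι) (f : ι → ℝ≥0∞) {α : ℝ} (hα : 0 < α) :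
    (⨆ x ∈ s, f x) ^ α = ⨆ x ∈ s, f x ^ α := by
  have := (ENNReal.orderIsoRpow α hα).map_iSup₂ fun x (_ : x ∈ s) => f x
  simpa only [ENNReal.orderIsoRpow_apply] using this

/-- The layer `{2^m < V ≤ 2^(m+1)}`. -/
def layer (V : ℝ → ℝ≥0∞) (m : ℤ) : Set ℝ :=
  {x | (2 : ℝ≥0∞) ^ (m : ℝ) < V x ∧ V x ≤ 2 * 2 ^ (m : ℝ)}

/-- `sup_{s ≤ t} f(s)`. -/
noncomputable def hull (f : ℝ → ℝ≥0∞) (t : ℝ) : ℝ≥0∞ := ⨆ s ∈ Iic t, f s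

theorem le_hull (f : ℝ → ℝ≥0∞) {s t : ℝ} (h : s ≤ t) : f s ≤ hull f t :=
  le_iSup₂_of_le s h le_rfl

theorem monotone_hull (f : ℝ → ℝ≥0∞) : Monotone (hull f) := fun _ _ h =>
  biSup_mono fun _ hs => le_trans hs h

section Layers

variable (ν : Measure ℝ)

theorem antitone_measure_Ici : Antitone fun x => ν (Ici x) := fun _ _ h =>
  measure_mono (Ici_subset_Ici.2 h)

theorem measure_sublevel_le (c : ℝ≥0∞) : ν {x | ν (Ici x) ≤ c} ≤ c := by
  rw [isRayFamily_Ici.measure_eq_iSup ν (T := {x | ν (Ici x) ≤ c}) fun x hx t ht =>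
    (antitone_measure_Ici ν ht).trans hx]
  exact iSup₂_le fun x hx => hx

theorem le_measure_sublevel {c : ℝ≥0∞} (hc : c ≠ ∞) {s : ℝ} (hs : c < ν (Ici s))
    (hs' : ν (Ici s) ≠ ∞) [NullSingletonClass ν] : c ≤ ν {x | ν (Ici x) ≤ c} := by
  set T : Set ℝ := {x | c < ν (Ici x)} with hT
  have hclosed : ∀ x ∈ T, Iic x ⊆ T := fun x hx t ht =>
    lt_of_lt_of_le hx (antitone_measure_Ici ν ht)
  have hTm := isRayFamily_Iic.measurableSet_of_closed hclosed
  have h1 : (ν.restrict (Ici s)) T ≤ ν (Ici s) - c := by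
    rw [isRayFamily_Iic.measure_eq_iSup _ hclosed]
    refine iSup₂_le fun x hx => ENNReal.le_sub_of_add_le_left hc ?_
    rw [Measure.restrict_apply measurableSet_Iic, inter_comm, Ici_inter_Iic]
    rcases lt_or_ge x s with hxs | hxs
    · rw [Icc_eq_empty hxs.not_ge, measure_empty, add_zero]
      exact hs.le
    · rw [← Ico_ae_eq_Icc.measure_eq, ← Ico_union_Ici_eq_Ici hxs,
        measure_union (disjoint_left.2 fun y hy hy' => hy.2.not_ge hy') measurableSet_Ici, add_comm]
      gcongr
      exact le_of_lt hx
  have h2 : ν (Ici s) ≤ (ν (Ici s) - c) + ν {x | ν (Ici x) ≤ c} := by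
    calc ν (Ici s) = (ν.restrict (Ici s)) T + (ν.restrict (Ici s)) Tᶜ := by
          rw [measure_add_measure_compl hTm, Measure.restrict_apply_univ]
      _ ≤ _ := by
          refine add_le_add h1 ((Measure.restrict_le_self _).trans_eq ?_)
          congr 1
          ext x
          simp [T]
  calc c = ν (Ici s) - (ν (Ici s) - c) := (ENNReal.sub_sub_cancel hs' hs.le).symm
    _ ≤ _ := tsub_le_iff_left.2 h2

theorem measurableSet_layer {V : ℝ → ℝ≥0∞} (hV : Measurable V) (m : ℤ) :
    MeasurableSet (layer V m) :=
  (measurableSet_lt measurable_const hV).inter (measurableSet_le hV measurable_const)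

theorem pairwise_disjoint_layer (V : ℝ → ℝ≥0∞) :
    Pairwise (Function.onFun Disjoint (layer V)) := fun _ _ hmn =>
  disjoint_left.2 fun _ hx hy => hmn (dyadic_unique hx.1 hx.2 hy.1 hy.2)

theorem two_mul_two_rpow_sub_one (m : ℤ) :
    (2 : ℝ≥0∞) * 2 ^ ((m - 1 : ℤ) : ℝ) = 2 ^ (m : ℝ) := by
  calc (2 : ℝ≥0∞) * 2 ^ ((m - 1 : ℤ) : ℝ) = 2 ^ (1 : ℝ) * 2 ^ ((m - 1 : ℤ) : ℝ) := by
        rw [ENNReal.rpow_one]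
    _ = _ := by rw [← two_rpow_add]; congr 1; push_cast; ring

theorem le_measure_layer [NullSingletonClass ν] {m : ℤ} (h : (layer (fun x => ν (Ici x)) m).Nonempty) :
    (2 : ℝ≥0∞) ^ ((m - 1 : ℤ) : ℝ) ≤ ν (layer (fun x => ν (Ici x)) (m - 1)) := by
  obtain ⟨s, hs, hs'⟩ := h
  have h1 := le_measure_sublevel ν (two_rpow_ne_top _) hs
    (ne_top_of_le_ne_top (ENNReal.mul_ne_top (by simp) (two_rpow_ne_top _)) hs')
  have h2 : {x | ν (Ici x) ≤ 2 ^ (m : ℝ)} ⊆ layer (fun x => ν (Ici x)) (m - 1) ∪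
      {x | ν (Ici x) ≤ 2 ^ ((m - 1 : ℤ) : ℝ)} := by
    intro x hx
    by_cases h : ν (Ici x) ≤ 2 ^ ((m - 1 : ℤ) : ℝ)
    · exact Or.inr h
    · exact Or.inl ⟨not_le.1 h, by rw [two_mul_two_rpow_sub_one]; exact hx⟩
  have h3 := h1.trans ((measure_mono h2).trans ((measure_union_le _ _).trans
    (add_le_add_right (measure_sublevel_le ν _) _)))
  rw [← two_mul_two_rpow_sub_one, two_mul] at h3
  exact (ENNReal.add_le_add_iff_right (two_rpow_ne_top _)).1 h3

/-- The dyadic coefficients `2^m sup_{layer m} g`. -/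
noncomputable def layerSup (V g : ℝ → ℝ≥0∞) (m : ℤ) : ℝ≥0∞ := 2 ^ (m : ℝ) * ⨆ x ∈ layer V m, g x

theorem tsum_layerSup_le [NullSingletonClass ν] {g : ℝ → ℝ≥0∞} (hg : Monotone g) :
    ∑' m, layerSup (fun x => ν (Ici x)) g m ≤ 2 * ∫⁻ x, g x ∂ν := by
  set V : ℝ → ℝ≥0∞ := fun x => ν (Ici x) with hV
  have hVm : Measurable V := (antitone_measure_Ici ν).measurable
  have key : ∀ m, layerSup V g m ≤ 2 * ∫⁻ x in layer V (m - 1), g x ∂ν := by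
    intro m
    rcases (layer V m).eq_empty_or_nonempty with h | h
    · simp [layerSup, h]
    · have h1 : ∀ t ∈ layer V (m - 1), ⨆ x ∈ layer V m, g x ≤ g t := by
        intro t ht
        refine iSup₂_le fun x hx => hg ?_
        by_contra hlt
        have h2 := antitone_measure_Ici ν (not_le.1 hlt).le
        have h3 := ht.2
        rw [two_mul_two_rpow_sub_one] at h3
        exact ((hx.1.trans_le h2).trans_le h3).false
      calc layerSup V g m = 2 * ((⨆ x ∈ layer V m, g x) * 2 ^ ((m - 1 : ℤ) : ℝ)) := by
            rw [layerSup, ← two_mul_two_rpow_sub_one]; ring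
        _ ≤ 2 * ((⨆ x ∈ layer V m, g x) * ν (layer V (m - 1))) := by
            gcongr
            exact le_measure_layer ν h
        _ = 2 * ∫⁻ _ in layer V (m - 1), (⨆ x ∈ layer V m, g x) ∂ν := by rw [setLIntegral_const]
        _ ≤ _ := by
            gcongr 2 * ?_
            exact setLIntegral_mono' (measurableSet_layer hVm _) h1
  calc ∑' m, layerSup V g m ≤ ∑' m : ℤ, 2 * ∫⁻ x in layer V (m - 1), g x ∂ν :=
        ENNReal.tsum_le_tsum key
    _ = 2 * ∑' m : ℤ, ∫⁻ x in layer V m, g x ∂ν := by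
        rw [ENNReal.tsum_mul_left]
        congr 1
        exact (Equiv.subRight (1 : ℤ)).tsum_eq fun m => ∫⁻ x in layer V m, g x ∂ν
    _ = 2 * ∫⁻ x in ⋃ m, layer V m, g x ∂ν := by
        rw [lintegral_iUnion (measurableSet_layer hVm) (pairwise_disjoint_layer V)]
    _ ≤ _ := by
        gcongr
        exact Measure.restrict_le_self

end Layers

theorem hull_mul_rpow_le {U V g : ℝ → ℝ≥0∞} {α : ℝ} (hα : 0 < α) (hV : Antitone V)
    (hV0 : ∀ x, V x ≠ 0) (hUV : ∀ x, U x ≠ 0 → V x ≠ ∞) (t : ℝ) :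
    hull (fun s => U s * g s) t ^ α ≤ 4 ^ α *
      (∑' m : ℤ, (layer V m).indicator (fun t => layerSup V g m ^ α *
          ((2 : ℝ≥0∞) ^ (m * α) * hull (fun s => U s / V s ^ 2) t ^ α)) t +
        ⨆ m : ℤ, {t | V t ≤ 2 ^ (m : ℝ)}.indicator (fun _ =>
          layerSup V g m ^ α * layerSup V (hull fun s => U s / V s ^ 2) m ^ α) t) := by
  set Φ := hull fun s => U s / V s ^ 2 with hΦ
  rw [hull, iSup₂_rpow _ _ hα]
  refine iSup₂_le fun s (hs : s ≤ t) => ?_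
  by_cases hU : U s = 0
  · simp [hU, hα]
  obtain ⟨m, hm, hm'⟩ := exists_two_rpow_lt_le (hV0 s) (hUV s hU)
  have hUΦ : U s ≤ Φ s * V s ^ 2 := by
    have := le_hull (fun s => U s / V s ^ 2) (le_refl s)
    rwa [ENNReal.div_le_iff (pow_ne_zero 2 (hV0 s)) (ENNReal.pow_ne_top (hUV s hU))] at this
  have hgs : 2 ^ (m : ℝ) * g s ≤ layerSup V g m := by
    unfold layerSup
    gcongr
    exact le_iSup₂_of_le s ⟨hm, hm'⟩ le_rfl
  have hUg : U s * g s ≤ 4 * (layerSup V g m * (2 ^ (m : ℝ) * Φ s)) := by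
    calc U s * g s ≤ Φ s * (2 * 2 ^ (m : ℝ)) ^ 2 * g s := by
          gcongr
          exact hUΦ.trans (by gcongr)
      _ = 4 * ((2 ^ (m : ℝ) * g s) * (2 ^ (m : ℝ) * Φ s)) := by ring
      _ ≤ _ := by gcongr
  calc (U s * g s) ^ α ≤ (4 * (layerSup V g m * (2 ^ (m : ℝ) * Φ s))) ^ α := by gcongr
    _ = 4 ^ α * (layerSup V g m ^ α * (2 ^ (m : ℝ) * Φ s) ^ α) := by
        rw [ENNReal.mul_rpow_of_nonneg _ _ hα.le, ENNReal.mul_rpow_of_nonneg _ _ hα.le]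
    _ ≤ _ := by
        gcongr
        by_cases ht : V t ≤ 2 ^ (m : ℝ)
        · refine le_add_of_le_right (le_iSup_of_le m ?_)
          rw [indicator_of_mem (show t ∈ {t | V t ≤ 2 ^ (m : ℝ)} from ht)]
          gcongr
          unfold layerSup
          gcongr
          exact le_iSup₂_of_le s ⟨hm, hm'⟩ le_rfl
        · refine le_add_of_le_left (le_trans ?_ (ENNReal.le_tsum m))
          rw [indicator_of_mem (show t ∈ layer V m from ⟨not_le.1 ht, (hV hs).trans hm'⟩),
            ENNReal.mul_rpow_of_nonneg _ _ hα.le, ← ENNReal.rpow_mul]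
          gcongr
          exact monotone_hull _ hs

theorem lintegral_hull_mul_rpow_le {U V g : ℝ → ℝ≥0∞} {α : ℝ} (hα : 0 < α) (hV : Antitone V)
    (hV0 : ∀ x, V x ≠ 0) (hUV : ∀ x, U x ≠ 0 → V x ≠ ∞) (ω : Measure ℝ) :
    ∫⁻ t, hull (fun s => U s * g s) t ^ α ∂ω ≤ 4 ^ α *
      (∑' m : ℤ, layerSup V g m ^ α * ((2 : ℝ≥0∞) ^ (m * α) *
          ω.withDensity (fun t => hull (fun s => U s / V s ^ 2) t ^ α) (layer V m)) +
        ∫⁻ t, ⨆ m : ℤ, {t | V t ≤ 2 ^ (m : ℝ)}.indicator (fun _ =>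
          layerSup V g m ^ α * layerSup V (hull fun s => U s / V s ^ 2) m ^ α) t ∂ω) := by
  have hΦ : Measurable fun t => hull (fun s => U s / V s ^ 2) t ^ α :=
    (monotone_hull _).measurable.pow_const α
  have hl := measurableSet_layer hV.measurable
  have hm : ∀ m : ℤ, Measurable ((layer V m).indicator (fun t => layerSup V g m ^ α *
          ((2 : ℝ≥0∞) ^ (m * α) * hull (fun s => U s / V s ^ 2) t ^ α))) := fun m =>
    ((hΦ.const_mul _).const_mul _).indicator (hl m)
  refine (lintegral_mono (hull_mul_rpow_le hα hV hV0 hUV)).trans_eq ?_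
  rw [lintegral_const_mul' _ _ (ENNReal.rpow_ne_top_of_nonneg hα.le (by simp)),
    lintegral_add_left (.tsum hm), lintegral_tsum fun m => (hm m).aemeasurable]
  congr 2
  refine tsum_congr fun m => ?_
  rw [lintegral_indicator (hl m), lintegral_const_mul _ (hΦ.const_mul _),
    lintegral_const_mul _ hΦ, withDensity_apply _ (hl m)]

section Upper

variable {U g : ℝ → ℝ≥0∞} {ν ω : Measure ℝ}

theorem lintegral_hull_mul_rpow_le_of_one_le [NullSingletonClass ν] {α : ℝ} (hα : 1 ≤ α)
    (hV0 : ∀ x, ν (Ici x) ≠ 0) (hUV : ∀ x, U x ≠ 0 → ν (Ici x) ≠ ∞) (hg : Monotone g) {A : ℝ≥0∞}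
    (hA : ∀ x, (hull (fun s => U s / ν (Ici s) ^ 2) x ^ α * ω (Ici x) +
      ω.withDensity (fun t => hull (fun s => U s / ν (Ici s) ^ 2) t ^ α) (Iic x)) *
        ν (Ici x) ^ α ≤ A) :
    ∫⁻ t, hull (fun s => U s * g s) t ^ α ∂ω ≤ 4 ^ α * (A + A) * (2 * ∫⁻ x, g x ∂ν) ^ α := by
  have hα0 : 0 < α := by linarith
  have hV := antitone_measure_Ici ν
  refine (lintegral_hull_mul_rpow_le hα0 hV hV0 hUV ω).trans ?_
  set V : ℝ → ℝ≥0∞ := fun x => ν (Ici x)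
  set Φ := hull fun s => U s / V s ^ 2
  set μ := ω.withDensity fun t => Φ t ^ α
  have hnear : ∀ m : ℤ, (2 : ℝ≥0∞) ^ (m * α) * μ (layer V m) ≤ A := by
    intro m
    have hT : ∀ x ∈ {x | (2 : ℝ≥0∞) ^ (m : ℝ) < V x}, Iic x ⊆ {x | (2 : ℝ≥0∞) ^ (m : ℝ) < V x} :=
      fun x hx t ht => lt_of_lt_of_le hx (hV ht)
    calc (2 : ℝ≥0∞) ^ (m * α) * μ (layer V m)
        ≤ (2 : ℝ≥0∞) ^ (m * α) * μ {x | (2 : ℝ≥0∞) ^ (m : ℝ) < V x} := by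
          gcongr
          exact fun x hx => hx.1
      _ = ⨆ x ∈ {x | (2 : ℝ≥0∞) ^ (m : ℝ) < V x}, (2 : ℝ≥0∞) ^ (m * α) * μ (Iic x) := by
          rw [isRayFamily_Iic.measure_eq_iSup μ hT]
          simp only [ENNReal.mul_iSup]
      _ ≤ A := by
          refine iSup₂_le fun x hx => le_trans ?_ (hA x)
          rw [mul_comm, ENNReal.rpow_mul]
          gcongr
          · exact le_add_self
          · exact le_of_lt hx
  have hfar : ∀ m : ℤ, layerSup V Φ m ^ α * ω {t | V t ≤ 2 ^ (m : ℝ)} ≤ A := by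
    intro m
    have : layerSup V Φ m = ⨆ x ∈ layer V m, 2 ^ (m : ℝ) * Φ x := by
      simp only [layerSup, ENNReal.mul_iSup]
    rw [this, iSup₂_rpow _ _ hα0]
    simp only [ENNReal.iSup_mul]
    refine iSup₂_le fun x hx => le_trans ?_ (hA x)
    rw [ENNReal.mul_rpow_of_nonneg _ _ hα0.le, mul_assoc, mul_comm]
    gcongr
    · refine le_add_of_le_left ?_
      gcongr
      intro t ht
      by_contra h
      exact (hx.1.trans_le ((hV (not_le.1 h).le).trans ht)).false
    · exact hx.1.le
  have hm : ∀ m : ℤ, MeasurableSet {t | V t ≤ (2 : ℝ≥0∞) ^ (m : ℝ)} := fun m =>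
    measurableSet_le hV.measurable measurable_const
  rw [mul_assoc]
  gcongr
  calc _ ≤ ∑' m : ℤ, layerSup V g m ^ α * A + ∑' m : ℤ, layerSup V g m ^ α * A := by
        gcongr with m
        · exact hnear m
        · calc _ ≤ ∫⁻ t, ∑' m : ℤ, {t | V t ≤ (2 : ℝ≥0∞) ^ (m : ℝ)}.indicator (fun _ =>
                layerSup V g m ^ α * layerSup V Φ m ^ α) t ∂ω :=
                lintegral_mono fun t => iSup_le fun m => ENNReal.le_tsum m
            _ = ∑' m : ℤ, layerSup V g m ^ α *
                (layerSup V Φ m ^ α * ω {t | V t ≤ 2 ^ (m : ℝ)}) := by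
                rw [lintegral_tsum fun m => (measurable_const.indicator (hm m)).aemeasurable]
                refine tsum_congr fun m => ?_
                rw [lintegral_indicator (hm m), setLIntegral_const, mul_assoc]
            _ ≤ _ := by
                gcongr with m
                exact hfar m
    _ = (A + A) * ∑' m : ℤ, layerSup V g m ^ α := by
        rw [ENNReal.tsum_mul_right]; ring
    _ ≤ (A + A) * (2 * ∫⁻ x, g x ∂ν) ^ α := by
        gcongr
        refine (tsum_rpow_le hα _).trans ?_
        gcongr
        exact tsum_layerSup_le ν hg

theorem lintegral_hull_mul_rpow_le_of_lt_one [NullSingletonClass ν] {α β : ℝ} (hα0 : 0 < α)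
    (hα1 : α < 1) (hβ0 : 0 < β) (hβ : β * (1 - α) = α)
    (hV0 : ∀ x, ν (Ici x) ≠ 0) (hUV : ∀ x, U x ≠ 0 → ν (Ici x) ≠ ∞) (hW0 : ∀ x, ω (Ici x) ≠ 0)
    (hg : Monotone g) {X Y : ℝ≥0∞}
    (hX : ∫⁻ x, ω.withDensity (fun t => hull (fun s => U s / ν (Ici s) ^ 2) t ^ α) (Iic x) ^ β *
      ν (Ici x) ^ β ∂ω.withDensity (fun t => hull (fun s => U s / ν (Ici s) ^ 2) t ^ α) ≤ X)
    (hY : ∫⁻ x, ω (Ici x) ^ β *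
      hull (fun t => hull (fun s => U s / ν (Ici s) ^ 2) t * ν (Ici t)) x ^ β ∂ω ≤ Y)
    (hYtop : Y ≠ ∞) :
    ∫⁻ t, hull (fun s => U s * g s) t ^ α ∂ω ≤ 4 ^ α * ((2 ^ (β + 1) * X) ^ (1 - α) +
      2 ^ α * (2 ^ (β + 1) * (geomConst β * Y)) ^ (1 - α)) * (2 * ∫⁻ x, g x ∂ν) ^ α := by
  have hV := antitone_measure_Ici ν
  refine (lintegral_hull_mul_rpow_le hα0 hV hV0 hUV ω).trans ?_
  have hθ : (1 - α)⁻¹ = β + 1 := by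
    have : 1 - α ≠ 0 := by linarith
    field_simp
    linarith
  have hθ0 : 0 ≤ β + 1 := by linarith
  have hα1' : 0 ≤ 1 - α := by linarith
  have eα : ∀ m : ℤ, (m : ℝ) * α * (β + 1) = m * β := fun m => by
    linear_combination (-(m : ℝ)) * hβ
  have hΓ := tsum_layerSup_le ν hg
  have hWm := isRayFamily_Ici.measurable_measure ω
  set V : ℝ → ℝ≥0∞ := fun x => ν (Ici x)
  set Φ := hull fun s => U s / V s ^ 2
  set μ := ω.withDensity fun t => Φ t ^ α
  set Ψ := hull fun t => Φ t * V t
  set γ := layerSup V g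
  set a := layerSup V Φ
  have hμm := isRayFamily_Iic.measurable_measure μ
  have hΨm : Measurable Ψ := (monotone_hull _).measurable
  have hnear : ∑' m : ℤ, γ m ^ α * ((2 : ℝ≥0∞) ^ (m * α) * μ (layer V m)) ≤
      (2 * ∫⁻ x, g x ∂ν) ^ α * (2 ^ (β + 1) * X) ^ (1 - α) := by
    refine (tsum_rpow_mul_le hα0 hα1 _ _).trans ?_
    rw [hθ]
    gcongr
    calc ∑' m : ℤ, ((2 : ℝ≥0∞) ^ (m * α) * μ (layer V m)) ^ (β + 1)
        ≤ ∑' m : ℤ, 2 ^ (β + 1) * ∫⁻ x in layer V m, μ (Iic x) ^ β * V x ^ β ∂μ := by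
          refine ENNReal.tsum_le_tsum fun m => ?_
          rw [ENNReal.mul_rpow_of_nonneg _ _ hθ0, ← ENNReal.rpow_mul, eα]
          calc (2 : ℝ≥0∞) ^ (m * β) * μ (layer V m) ^ (β + 1)
              ≤ (2 : ℝ≥0∞) ^ (m * β) *
                  (2 ^ (β + 1) * ∫⁻ x in layer V m, μ (Iic x) ^ β ∂μ) := by
                gcongr
                exact isRayFamily_Iic.measure_rpow_le μ hβ0.le _
            _ = 2 ^ (β + 1) * ∫⁻ x in layer V m, μ (Iic x) ^ β * 2 ^ (m * β) ∂μ := by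
                rw [lintegral_mul_const _ (hμm.pow_const β)]
                ring
            _ ≤ _ := by
                gcongr 2 ^ (β + 1) * ?_
                refine setLIntegral_mono' (measurableSet_layer hV.measurable m) fun x hx => ?_
                rw [ENNReal.rpow_mul]
                gcongr
                exact hx.1.le
      _ = 2 ^ (β + 1) * ∫⁻ x in ⋃ m, layer V m, μ (Iic x) ^ β * V x ^ β ∂μ := by
          rw [ENNReal.tsum_mul_left, lintegral_iUnion (measurableSet_layer hV.measurable)
            (pairwise_disjoint_layer V)]
      _ ≤ _ := by
          gcongr
          exact (setLIntegral_le_lintegral _ _).trans hX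
  set Γ : ℤ → ℝ≥0∞ := fun l => ∑' m : ℤ,
    (if (2 : ℝ≥0∞) ^ (l : ℝ) < a m ∧ a m ≤ 2 * 2 ^ (l : ℝ) then γ m else 0) with hΓdef
  have hΓsum : ∑' l, Γ l ≤ ∑' m, γ m := by
    rw [hΓdef, ENNReal.tsum_comm]
    exact ENNReal.tsum_le_tsum fun m => tsum_dyadic_le (a m) (γ m)
  have hΨfin : ∀ᵐ t ∂ω, Ψ t < ∞ := by
    have := ae_lt_top ((hWm.pow_const β).mul (hΨm.pow_const β)) (ne_top_of_le_ne_top hYtop hY)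
    filter_upwards [this] with t ht
    by_contra h
    rw [not_lt_top_iff] at h
    change ω (Ici t) ^ β * Ψ t ^ β < ∞ at ht
    rw [h, ENNReal.top_rpow_of_pos hβ0, ENNReal.mul_top] at ht
    · exact ht.false
    · rw [Ne, ENNReal.rpow_eq_zero_iff_of_pos hβ0]
      exact hW0 t
  have hYm : ∀ l : ℤ, MeasurableSet {t | (2 : ℝ≥0∞) ^ (l : ℝ) < Ψ t} := fun l =>
    measurableSet_lt measurable_const hΨm
  have haΨ : ∀ (m : ℤ) (t : ℝ), V t ≤ 2 ^ (m : ℝ) → a m ≤ Ψ t := by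
    intro m t ht
    simp only [a, layerSup, ENNReal.mul_iSup]
    refine iSup₂_le fun x hx => ?_
    have hxt : x ≤ t := by
      by_contra h
      exact (hx.1.trans_le ((hV (not_le.1 h).le).trans ht)).false
    refine le_trans ?_ (le_hull (fun t => Φ t * V t) hxt)
    rw [mul_comm]
    gcongr
    exact hx.1.le
  have hpt : ∀ᵐ t ∂ω, ⨆ m : ℤ, {t | V t ≤ 2 ^ (m : ℝ)}.indicator (fun _ => γ m ^ α * a m ^ α) t
      ≤ ∑' l : ℤ, {t | (2 : ℝ≥0∞) ^ (l : ℝ) < Ψ t}.indicator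
        (fun _ => 2 ^ α * (Γ l ^ α * 2 ^ (l * α))) t := by
    filter_upwards [hΨfin] with t ht
    refine iSup_le fun m => ?_
    by_cases hVt : V t ≤ 2 ^ (m : ℝ)
    · rw [indicator_of_mem (show t ∈ {t | V t ≤ 2 ^ (m : ℝ)} from hVt)]
      have ha := haΨ m t hVt
      by_cases ha0 : a m = 0
      · rw [ha0, ENNReal.zero_rpow_of_pos hα0, mul_zero]
        exact bot_le
      obtain ⟨l, hl, hl'⟩ := exists_two_rpow_lt_le ha0 (ha.trans_lt ht).ne
      refine le_trans ?_ (ENNReal.le_tsum l)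
      rw [indicator_of_mem (show t ∈ {t | (2 : ℝ≥0∞) ^ (l : ℝ) < Ψ t} from hl.trans_le ha)]
      calc γ m ^ α * a m ^ α ≤ Γ l ^ α * (2 * 2 ^ (l : ℝ)) ^ α := by
            gcongr
            refine le_trans ?_ (ENNReal.le_tsum m)
            rw [if_pos ⟨hl, hl'⟩]
        _ = _ := by
            rw [ENNReal.mul_rpow_of_nonneg _ _ hα0.le, ← ENNReal.rpow_mul]
            ring
    · rw [indicator_of_notMem (show t ∉ {t | V t ≤ 2 ^ (m : ℝ)} from hVt)]
      exact bot_le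
  have hlevels : ∑' l : ℤ, (2 : ℝ≥0∞) ^ (l * β) * ω {t | (2 : ℝ≥0∞) ^ (l : ℝ) < Ψ t} ^ (β + 1) ≤
      2 ^ (β + 1) * (geomConst β * Y) := by
    calc _ ≤ ∑' l : ℤ, 2 ^ (β + 1) * ∫⁻ t in {t | (2 : ℝ≥0∞) ^ (l : ℝ) < Ψ t},
            ω (Ici t) ^ β * 2 ^ (l * β) ∂ω := by
          refine ENNReal.tsum_le_tsum fun l => ?_
          rw [lintegral_mul_const _ (hWm.pow_const β), ← mul_assoc, mul_comm]
          gcongr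
          exact isRayFamily_Ici.measure_rpow_le ω hβ0.le _
      _ = 2 ^ (β + 1) * ∫⁻ t, ∑' l : ℤ, {t | (2 : ℝ≥0∞) ^ (l : ℝ) < Ψ t}.indicator
            (fun t => ω (Ici t) ^ β * 2 ^ (l * β)) t ∂ω := by
          rw [lintegral_tsum fun l =>
            (((hWm.pow_const β).mul_const _).indicator (hYm l)).aemeasurable, ENNReal.tsum_mul_left]
          simp only [lintegral_indicator (hYm _)]
      _ ≤ 2 ^ (β + 1) * ∫⁻ t, geomConst β * (ω (Ici t) ^ β * Ψ t ^ β) ∂ω := by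
          gcongr with t
          calc _ = ω (Ici t) ^ β * ∑' l : ℤ,
                (if (2 : ℝ≥0∞) ^ (l : ℝ) < Ψ t then (2 : ℝ≥0∞) ^ (l * β) else 0) := by
                rw [← ENNReal.tsum_mul_left]
                refine tsum_congr fun l => ?_
                simp only [indicator_apply, mem_ofPred_eq]
                split_ifs <;> simp
            _ ≤ ω (Ici t) ^ β * (geomConst β * Ψ t ^ β) := by
                gcongr
                exact tsum_two_rpow_le hβ0 _
            _ = _ := by ring
      _ ≤ _ := by
          rw [lintegral_const_mul' _ _ (geomConst_ne_top hβ0)]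
          gcongr
  have hfar : ∫⁻ t, ⨆ m : ℤ, {t | V t ≤ 2 ^ (m : ℝ)}.indicator (fun _ => γ m ^ α * a m ^ α) t ∂ω ≤
      (2 * ∫⁻ x, g x ∂ν) ^ α * (2 ^ α * (2 ^ (β + 1) * (geomConst β * Y)) ^ (1 - α)) := by
    calc _ ≤ ∫⁻ t, ∑' l : ℤ, {t | (2 : ℝ≥0∞) ^ (l : ℝ) < Ψ t}.indicator
          (fun _ => 2 ^ α * (Γ l ^ α * 2 ^ (l * α))) t ∂ω := lintegral_mono_ae hpt
      _ = 2 ^ α * ∑' l : ℤ, Γ l ^ α *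
          ((2 : ℝ≥0∞) ^ (l * α) * ω {t | (2 : ℝ≥0∞) ^ (l : ℝ) < Ψ t}) := by
          rw [lintegral_tsum fun l => (measurable_const.indicator (hYm l)).aemeasurable,
            ← ENNReal.tsum_mul_left]
          refine tsum_congr fun l => ?_
          rw [lintegral_indicator (hYm l), setLIntegral_const]
          ring
      _ ≤ 2 ^ α * ((∑' l, Γ l) ^ α * (∑' l : ℤ, ((2 : ℝ≥0∞) ^ (l * α) *
          ω {t | (2 : ℝ≥0∞) ^ (l : ℝ) < Ψ t}) ^ (1 - α)⁻¹) ^ (1 - α)) := by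
          gcongr
          exact tsum_rpow_mul_le hα0 hα1 _ _
      _ ≤ 2 ^ α * ((2 * ∫⁻ x, g x ∂ν) ^ α *
          (2 ^ (β + 1) * (geomConst β * Y)) ^ (1 - α)) := by
          gcongr
          · exact hΓsum.trans hΓ
          · refine le_trans (le_of_eq (tsum_congr fun l => ?_)) hlevels
            rw [hθ, ENNReal.mul_rpow_of_nonneg _ _ hθ0, ← ENNReal.rpow_mul, eα]
      _ = _ := by ring
  rw [mul_assoc]
  gcongr
  refine (add_le_add hnear hfar).trans_eq ?_
  ring

end Upper

/-- `sup_{s < t} f(s)`. -/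
noncomputable def openHull (f : ℝ → ℝ≥0∞) (t : ℝ) : ℝ≥0∞ := ⨆ s ∈ Iio t, f s

theorem le_openHull (f : ℝ → ℝ≥0∞) {s t : ℝ} (h : s < t) : f s ≤ openHull f t :=
  le_iSup₂_of_le s h le_rfl

theorem ae_hull_le_openHull (ω : Measure ℝ) [NullSingletonClass ω] (f : ℝ → ℝ≥0∞) :
    ∀ᵐ t ∂ω, hull f t ≤ openHull f t := by
  filter_upwards [(monotone_hull f).countable_not_continuousAt.ae_notMem ω] with t ht
  have ht : ContinuousAt (hull f) t := by simpa using ht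
  refine le_of_tendsto (ht.tendsto.mono_left (nhdsWithin_le_nhds (s := Iio t))) ?_
  filter_upwards [self_mem_nhdsWithin] with s hs
  exact iSup₂_le fun r hr => le_openHull f (lt_of_le_of_lt hr hs)

theorem lintegral_truncated_inv_sq_le (ν : Measure ℝ) {x : ℝ} (hx : ν (Ici x) ≠ 0) :
    ∫⁻ t, (ν (Ici (min t x)) ^ 2)⁻¹ ∂ν ≤ 4 * (ν (Ici x))⁻¹ := by
  have hV := antitone_measure_Ici ν
  set V : ℝ → ℝ≥0∞ := fun x => ν (Ici x)
  set a := V x with ha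
  have hVa : ∀ t, a ≤ V (min t x) := fun t => hV (min_le_right t x)
  by_cases htop : a = ∞
  · have : ∀ t, V (min t x) = ∞ := fun t => top_le_iff.1 (htop ▸ hVa t)
    have h0 : ∀ t, (ν (Ici (min t x)) ^ 2)⁻¹ = 0 := fun t => by
      rw [show ν (Ici (min t x)) = ∞ from this t]; simp
    simp [h0]
  have hpt : ∀ t, (V (min t x) ^ 2)⁻¹ ≤ ∑' n : ℕ, {t | V t ≤ 2 * 2 ^ n * a}.indicator
      (fun _ => (a ^ 2)⁻¹ * (4 ^ n)⁻¹) t := by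
    intro t
    by_cases hy : V (min t x) = ∞
    · simp [hy]
    have h1 := hVa t
    have hVt : V t ≤ V (min t x) := hV (min_le_left t x)
    generalize V (min t x) = y at h1 hVt hy
    obtain ⟨n, hn, hn'⟩ : ∃ n : ℕ, 2 ^ n * a ≤ y ∧ y ≤ 2 * 2 ^ n * a := by
      have hx' : a ≠ 0 := hx
      clear_value a
      lift a to ℝ≥0 using htop
      lift y to ℝ≥0 using hy
      have ha0 : 0 < a := pos_iff_ne_zero.2 (by simpa using hx')
      have h1' : a ≤ y := by exact_mod_cast h1
      obtain ⟨n, hn, hn'⟩ := exists_nat_pow_near ((one_le_div ha0).2 h1') (one_lt_two (α := ℝ≥0))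
      refine ⟨n, ?_, ?_⟩
      · rw [le_div_iff₀ ha0] at hn
        exact_mod_cast hn
      · rw [div_lt_iff₀ ha0, pow_succ'] at hn'
        exact_mod_cast hn'.le
    refine le_trans ?_ (ENNReal.le_tsum n)
    rw [indicator_of_mem (show t ∈ {t | V t ≤ 2 * 2 ^ n * a} from hVt.trans hn'),
      ← ENNReal.mul_inv (Or.inr (by simp)) (Or.inr (by simp))]
    refine ENNReal.inv_le_inv.2 ?_
    calc a ^ 2 * 4 ^ n = (2 ^ n * a) ^ 2 := by
          rw [show (4 : ℝ≥0∞) = 2 * 2 by norm_num, mul_pow]; ring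
      _ ≤ _ := by gcongr
  have hm : ∀ n : ℕ, MeasurableSet {t | V t ≤ 2 * 2 ^ n * a} := fun n =>
    measurableSet_le hV.measurable measurable_const
  calc ∫⁻ t, (V (min t x) ^ 2)⁻¹ ∂ν
      ≤ ∫⁻ t, ∑' n : ℕ, {t | V t ≤ 2 * 2 ^ n * a}.indicator
        (fun _ => (a ^ 2)⁻¹ * (4 ^ n)⁻¹) t ∂ν := lintegral_mono hpt
    _ = ∑' n : ℕ, (a ^ 2)⁻¹ * (4 ^ n)⁻¹ * ν {t | V t ≤ 2 * 2 ^ n * a} := by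
        rw [lintegral_tsum fun n => (measurable_const.indicator (hm n)).aemeasurable]
        refine tsum_congr fun n => ?_
        rw [lintegral_indicator (hm n), setLIntegral_const]
    _ ≤ ∑' n : ℕ, (a ^ 2)⁻¹ * (4 ^ n)⁻¹ * (2 * 2 ^ n * a) := by
        gcongr with n
        exact measure_sublevel_le ν _
    _ = ∑' n : ℕ, 2 * a⁻¹ * 2⁻¹ ^ n := by
        refine tsum_congr fun n => ?_
        have e1 : (a ^ 2)⁻¹ * a = a⁻¹ := by
          rw [pow_two, ENNReal.mul_inv (Or.inl hx) (Or.inl htop), mul_assoc,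
            ENNReal.inv_mul_cancel hx htop, mul_one]
        have e2 : ((4 : ℝ≥0∞) ^ n)⁻¹ * 2 ^ n = 2⁻¹ ^ n := by
          rw [show (4 : ℝ≥0∞) = 2 * 2 by norm_num, mul_pow,
            ENNReal.mul_inv (Or.inl (by simp)) (Or.inl (by simp)), mul_assoc,
            ENNReal.inv_mul_cancel (by simp) (by simp), mul_one, ENNReal.inv_pow]
        calc _ = 2 * ((a ^ 2)⁻¹ * a) * (((4 : ℝ≥0∞) ^ n)⁻¹ * 2 ^ n) := by ring
          _ = _ := by rw [e1, e2]
    _ = 4 * a⁻¹ := by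
        rw [ENNReal.tsum_mul_left, ENNReal.tsum_geometric, ENNReal.one_sub_inv_two, inv_inv]
        ring

section Lower

variable {U : ℝ → ℝ≥0∞} {ν ω : Measure ℝ}

theorem hull_hull_mul_le {V : ℝ → ℝ≥0∞} (hV : Antitone V) (hV0 : ∀ x, V x ≠ 0)
    (hUV : ∀ x, U x ≠ 0 → V x ≠ ∞) (x : ℝ) :
    hull (fun t => hull (fun s => U s / V s ^ 2) t * V t) x ≤ hull (fun s => U s / V s) x := by
  refine iSup₂_le fun t ht => ?_
  simp only [hull, ENNReal.iSup_mul]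
  refine iSup₂_le fun s hs => ?_
  refine le_trans ?_ (le_hull (fun s => U s / V s) (le_trans hs ht))
  by_cases hU : U s = 0
  · simp [hU]
  calc U s / V s ^ 2 * V t ≤ U s / V s ^ 2 * V s := by gcongr; exact hV hs
    _ = U s / V s := by
      rw [pow_two, div_eq_mul_inv, ENNReal.mul_inv (Or.inl (hV0 s)) (Or.inl (hUV s hU)),
        mul_assoc, mul_assoc, ENNReal.inv_mul_cancel (hV0 s) (hUV s hU), mul_one, div_eq_mul_inv]

theorem monotone_sum {M : Finset ℤ} {f : ℤ → ℝ → ℝ≥0∞} (hf : ∀ m, Monotone (f m)) :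
    Monotone fun t => ∑ m ∈ M, f m t := fun _ _ h =>
  Finset.sum_le_sum fun m _ => hf m h

theorem monotone_truncated_inv_sq (ν : Measure ℝ) (c : ℝ≥0∞) (x : ℝ) :
    Monotone fun t => c * (ν (Ici (min t x)) ^ 2)⁻¹ := fun _ _ h => by
  have := antitone_measure_Ici ν (min_le_min_right x h)
  dsimp only at this ⊢
  gcongr

theorem monotone_indicator_Ici (c : ℝ≥0∞) (x : ℝ) : Monotone ((Ici x).indicator fun _ => c) := by
  intro s t h
  by_cases hs : s ∈ Ici x
  · rw [indicator_of_mem hs, indicator_of_mem (show t ∈ Ici x from le_trans hs h)]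
  · rw [indicator_of_notMem hs]
    exact bot_le

theorem lintegral_iSup_Iic_le [NullSingletonClass ω] {α : ℝ} (hα : 0 < α)
    (hV0 : ∀ x, ν (Ici x) ≠ 0) {D : ℝ≥0∞}
    (hD : ∀ g : ℝ → ℝ≥0∞, Monotone g →
      ∫⁻ t, openHull (fun s => U s * g s) t ^ α ∂ω ≤ D * (∫⁻ x, g x ∂ν) ^ α)
    (N : Finset ℤ) (x : ℤ → ℝ) (c : ℤ → ℝ≥0∞) :
    ∫⁻ t, ⨆ m ∈ N, (Iic (x m)).indicator (fun _ => c m ^ α) t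
        ∂ω.withDensity (fun t => hull (fun s => U s / ν (Ici s) ^ 2) t ^ α) ≤
      D * (4 * ∑ m ∈ N, c m * (ν (Ici (x m)))⁻¹) ^ α := by
  set Φ := hull fun s => U s / ν (Ici s) ^ 2 with hΦ
  set g : ℝ → ℝ≥0∞ := fun t => ∑ m ∈ N, c m * (ν (Ici (min t (x m))) ^ 2)⁻¹ with hg
  have hgm : Monotone g := monotone_sum fun m => monotone_truncated_inv_sq ν _ _
  have hgint : ∫⁻ t, g t ∂ν ≤ 4 * ∑ m ∈ N, c m * (ν (Ici (x m)))⁻¹ := by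
    rw [hg, lintegral_finsetSum _ fun m _ => (monotone_truncated_inv_sq ν _ _).measurable,
      Finset.mul_sum]
    refine Finset.sum_le_sum fun m _ => ?_
    have hmeas : Measurable fun t => (ν (Ici (min t (x m))) ^ 2)⁻¹ := by
      simpa using (monotone_truncated_inv_sq ν 1 (x m)).measurable
    rw [lintegral_const_mul _ hmeas, mul_left_comm]
    gcongr
    exact lintegral_truncated_inv_sq_le ν (hV0 _)
  rw [lintegral_withDensity_eq_lintegral_mul₀ ((monotone_hull _).measurable.pow_const α).aemeasurable
    (Measurable.aemeasurable (.iSup fun m => .iSup fun _ =>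
      measurable_const.indicator measurableSet_Iic))]
  calc _ ≤ ∫⁻ t, openHull (fun s => U s * g s) t ^ α ∂ω := by
        refine lintegral_mono_ae ?_
        filter_upwards [ae_hull_le_openHull ω fun s => U s / ν (Ici s) ^ 2] with t ht
        simp only [Pi.mul_apply, ENNReal.mul_iSup]
        refine iSup₂_le fun m hm => ?_
        by_cases htx : t ∈ Iic (x m)
        · rw [indicator_of_mem htx, ← ENNReal.mul_rpow_of_nonneg _ _ hα.le]
          gcongr
          refine (mul_le_mul_left ht _).trans ?_
          simp only [openHull, ENNReal.iSup_mul]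
          refine iSup₂_le fun s (hs : s < t) => ?_
          refine le_trans ?_ (le_openHull (fun s => U s * g s) hs)
          rw [div_eq_mul_inv, mul_assoc]
          gcongr
          have hmin : min s (x m) = s := min_eq_left (hs.le.trans htx)
          refine le_trans ?_ (Finset.single_le_sum (fun _ _ => bot_le) hm)
          rw [hmin, mul_comm]
        · rw [indicator_of_notMem htx, mul_zero]
          exact bot_le
    _ ≤ D * (∫⁻ x, g x ∂ν) ^ α := hD g hgm
    _ ≤ _ := by gcongr

theorem lintegral_iSup_Ici_le [NullSingletonClass ω] {α : ℝ} (hα : 0 < α) {D : ℝ≥0∞}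
    (hD : ∀ g : ℝ → ℝ≥0∞, Monotone g →
      ∫⁻ t, openHull (fun s => U s * g s) t ^ α ∂ω ≤ D * (∫⁻ x, g x ∂ν) ^ α)
    (N : Finset ℤ) (x s : ℤ → ℝ) (hs : ∀ m ∈ N, s m ≤ x m) (η : ℤ → ℝ≥0∞) :
    ∫⁻ t, ⨆ m ∈ N, (Ici (x m)).indicator
        (fun _ => (U (s m) / ν (Ici (s m)) * η m) ^ α) t ∂ω ≤ D * (∑ m ∈ N, η m) ^ α := by
  set g : ℝ → ℝ≥0∞ := fun t => ∑ m ∈ N, (Ici (s m)).indicator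
    (fun _ => η m * (ν (Ici (s m)))⁻¹) t with hg
  have hgm : Monotone g := monotone_sum fun m => monotone_indicator_Ici _ _
  have hgint : ∫⁻ t, g t ∂ν ≤ ∑ m ∈ N, η m := by
    rw [hg, lintegral_finsetSum _ fun m _ => (monotone_indicator_Ici _ _).measurable]
    refine Finset.sum_le_sum fun m _ => ?_
    rw [lintegral_indicator measurableSet_Ici, setLIntegral_const, mul_assoc]
    exact mul_le_of_le_one_right bot_le (ENNReal.inv_mul_le_one _)
  have hne : ∀ᵐ t ∂ω, t ∉ (x '' N) := ((N.countable_toSet).image x).ae_notMem ω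
  calc _ ≤ ∫⁻ t, openHull (fun s => U s * g s) t ^ α ∂ω := by
        refine lintegral_mono_ae ?_
        filter_upwards [hne] with t ht
        refine iSup₂_le fun m hm => ?_
        by_cases htx : t ∈ Ici (x m)
        · rw [indicator_of_mem htx]
          gcongr
          have hlt : s m < t := (hs m hm).trans_lt
            (lt_of_le_of_ne htx fun h => ht ⟨m, hm, h⟩)
          refine le_trans ?_ (le_openHull (fun s => U s * g s) hlt)
          rw [div_eq_mul_inv, mul_assoc]
          gcongr
          refine le_trans ?_ (Finset.single_le_sum (fun _ _ => bot_le) hm)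
          rw [indicator_of_mem (self_mem_Ici (a := s m)), mul_comm]
        · rw [indicator_of_notMem htx]
          exact bot_le
    _ ≤ D * (∫⁻ x, g x ∂ν) ^ α := hD g hgm
    _ ≤ _ := by gcongr

theorem hull_rpow_mul_add_le [NullSingletonClass ω] {α : ℝ} (hα : 0 < α)
    (hV0 : ∀ x, ν (Ici x) ≠ 0) (hUV : ∀ x, U x ≠ 0 → ν (Ici x) ≠ ∞) {D : ℝ≥0∞}
    (hD : ∀ g : ℝ → ℝ≥0∞, Monotone g →
      ∫⁻ t, openHull (fun s => U s * g s) t ^ α ∂ω ≤ D * (∫⁻ x, g x ∂ν) ^ α) (x : ℝ) :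
    (hull (fun s => U s / ν (Ici s) ^ 2) x ^ α * ω (Ici x) +
      ω.withDensity (fun t => hull (fun s => U s / ν (Ici s) ^ 2) t ^ α) (Iic x)) *
        ν (Ici x) ^ α ≤ (1 + 4 ^ α) * D := by
  rw [add_mul, add_mul, one_mul]
  refine add_le_add ?_ ?_
  · calc _ = (hull (fun s => U s / ν (Ici s) ^ 2) x * ν (Ici x)) ^ α * ω (Ici x) := by
          rw [ENNReal.mul_rpow_of_nonneg _ _ hα.le]; ring
      _ ≤ hull (fun s => U s / ν (Ici s)) x ^ α * ω (Ici x) := by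
          gcongr
          exact (le_hull (fun t => hull (fun s => U s / ν (Ici s) ^ 2) t * ν (Ici t))
            (le_refl x)).trans (hull_hull_mul_le (antitone_measure_Ici ν) hV0 hUV x)
      _ ≤ D := by
          rw [hull, iSup₂_rpow _ _ hα]
          simp only [ENNReal.iSup_mul]
          refine iSup₂_le fun s hs => ?_
          have := lintegral_iSup_Ici_le hα hD {0} (fun _ => x) (fun _ => s)
            (fun _ _ => hs) (fun _ => 1)
          simpa [lintegral_indicator measurableSet_Ici] using this
  · have := lintegral_iSup_Iic_le hα hV0 hD {0} (fun _ => x) (fun _ => 1)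
    simp only [Finset.mem_singleton, iSup_iSup_eq_left, ENNReal.one_rpow, Finset.sum_singleton,
      one_mul, lintegral_indicator measurableSet_Iic, setLIntegral_const] at this
    calc _ ≤ D * (4 * (ν (Ici x))⁻¹) ^ α * ν (Ici x) ^ α := by gcongr
      _ = D * (4 * ((ν (Ici x))⁻¹ * ν (Ici x))) ^ α := by
          rw [mul_assoc, ← ENNReal.mul_rpow_of_nonneg _ _ hα.le, mul_assoc]
      _ ≤ D * (4 * 1) ^ α := by
          gcongr
          exact ENNReal.inv_mul_le_one _
      _ = 4 ^ α * D := by rw [mul_one, mul_comm]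

theorem lintegral_Iic_rpow_mul_le [NullSingletonClass ω] {α β : ℝ} (hα0 : 0 < α) (hα1 : α < 1)
    (hβ0 : 0 < β) (hβ : β * (1 - α) = α) (hV0 : ∀ x, ν (Ici x) ≠ 0) {D : ℝ≥0∞} (hDtop : D ≠ ∞)
    (hD : ∀ g : ℝ → ℝ≥0∞, Monotone g →
      ∫⁻ t, openHull (fun s => U s * g s) t ^ α ∂ω ≤ D * (∫⁻ x, g x ∂ν) ^ α) :
    ∫⁻ x, ω.withDensity (fun t => hull (fun s => U s / ν (Ici s) ^ 2) t ^ α) (Iic x) ^ β *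
      ν (Ici x) ^ β ∂ω.withDensity (fun t => hull (fun s => U s / ν (Ici s) ^ 2) t ^ α) ≤
      2 ^ β * (lowerConst β * (4 ^ α * D)) ^ (β + 1) := by
  refine lintegral_measure_ray_rpow_le isRayFamily_Iic _ hα0 hα1 hβ0 hβ
    (fun x t ht => antitone_measure_Ici ν ht)
    (ENNReal.mul_ne_top (ENNReal.rpow_ne_top_of_nonneg hα0.le (by simp)) hDtop)
    fun N x η hx _ => ?_
  refine (lintegral_iSup_Iic_le hα0 hV0 hD N x fun m => 2 ^ (m : ℝ) * η m).trans ?_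
  calc _ ≤ D * (4 * ∑ m ∈ N, η m) ^ α := by
        gcongr with m hm
        calc 2 ^ (m : ℝ) * η m * (ν (Ici (x m)))⁻¹ ≤ ν (Ici (x m)) * η m * (ν (Ici (x m)))⁻¹ := by
              gcongr
              exact (hx m hm).le
          _ = η m * (ν (Ici (x m)) * (ν (Ici (x m)))⁻¹) := by ring
          _ ≤ η m := mul_le_of_le_one_right bot_le (ENNReal.mul_inv_le_one _)
    _ = _ := by
        rw [ENNReal.mul_rpow_of_nonneg _ _ hα0.le]; ring

theorem lintegral_Ici_rpow_mul_le [NullSingletonClass ω] {α β : ℝ} (hα0 : 0 < α) (hα1 : α < 1)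
    (hβ0 : 0 < β) (hβ : β * (1 - α) = α) (hV0 : ∀ x, ν (Ici x) ≠ 0)
    (hUV : ∀ x, U x ≠ 0 → ν (Ici x) ≠ ∞) {D : ℝ≥0∞} (hDtop : D ≠ ∞)
    (hD : ∀ g : ℝ → ℝ≥0∞, Monotone g →
      ∫⁻ t, openHull (fun s => U s * g s) t ^ α ∂ω ≤ D * (∫⁻ x, g x ∂ν) ^ α) :
    ∫⁻ x, ω (Ici x) ^ β *
      hull (fun t => hull (fun s => U s / ν (Ici s) ^ 2) t * ν (Ici t)) x ^ β ∂ω ≤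
      2 ^ β * (lowerConst β * D) ^ (β + 1) := by
  refine lintegral_measure_ray_rpow_le isRayFamily_Ici _ hα0 hα1 hβ0 hβ
    (fun x t ht => monotone_hull _ ht) hDtop fun N x η hx _ => ?_
  have hex : ∀ m, ∃ s, m ∈ N → s ≤ x m ∧ (2 : ℝ≥0∞) ^ (m : ℝ) < U s / ν (Ici s) := by
    intro m
    by_cases hm : m ∈ N
    · have := (hx m hm).trans_le (hull_hull_mul_le (antitone_measure_Ici ν) hV0 hUV (x m))
      rw [hull, lt_iSup_iff] at this
      obtain ⟨s, hs⟩ := this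
      rw [lt_iSup_iff] at hs
      obtain ⟨hs, hs'⟩ := hs
      exact ⟨s, fun _ => ⟨hs, hs'⟩⟩
    · exact ⟨0, fun h => (hm h).elim⟩
  choose s hs using hex
  refine le_trans (lintegral_mono fun t => ?_)
    (lintegral_iSup_Ici_le hα0 hD N x s (fun m hm => (hs m hm).1) η)
  refine iSup₂_mono fun m hm => indicator_le_indicator ?_
  gcongr
  exact (hs m hm).2.le

end Lower

/-- The measure `w(t) dt` on `(0,∞)`. -/
noncomputable def weightMeasure (w : ℝ → ℝ) : Measure ℝ :=
  (volume.restrict (Ioi 0)).withDensity fun t => ENNReal.ofReal (w t)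

instance (w : ℝ → ℝ) : NullSingletonClass (weightMeasure w) where
  measure_singleton x := withDensity_absolutelyContinuous _ _ (measure_singleton x)

theorem IsWeight.aemeasurable {w : ℝ → ℝ} (hw : IsWeight w) :
    AEMeasurable (fun t => ENNReal.ofReal (w t)) (volume.restrict (Ioi 0)) :=
  hw.locallyIntegrable.aestronglyMeasurable.aemeasurable.ennreal_ofReal

theorem setLIntegral_weightMeasure {w : ℝ → ℝ} (hw : IsWeight w) {s : Set ℝ}
    (hs : MeasurableSet s) (F : ℝ → ℝ≥0∞) :
    ∫⁻ t in s, F t ∂weightMeasure w = ∫⁻ t in s ∩ Ioi 0, F t * ENNReal.ofReal (w t) := by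
  rw [weightMeasure, restrict_withDensity hs, Measure.restrict_restrict hs,
    lintegral_withDensity_eq_lintegral_mul_non_measurable₀ _
      (hw.aemeasurable.mono_measure (Measure.restrict_mono_set _ inter_subset_right))
      (Filter.Eventually.of_forall fun _ => ENNReal.ofReal_lt_top)]
  simp only [Pi.mul_apply, mul_comm]

theorem lintegral_weightMeasure {w : ℝ → ℝ} (hw : IsWeight w) (F : ℝ → ℝ≥0∞) :
    ∫⁻ t, F t ∂weightMeasure w = ∫⁻ t in Ioi 0, F t * ENNReal.ofReal (w t) := by
  rw [← setLIntegral_univ, setLIntegral_weightMeasure hw .univ, univ_inter]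

theorem weightMeasure_Ici (w : ℝ → ℝ) {t : ℝ} (ht : 0 < t) :
    weightMeasure w (Ici t) = tail w t := by
  have h : Ici t ∩ Ioi 0 = Ici t := inter_eq_left.2 (Ici_subset_Ioi.2 ht)
  rw [weightMeasure, withDensity_apply _ measurableSet_Ici,
    Measure.restrict_restrict measurableSet_Ici, h, tail]
  exact (setLIntegral_congr Ioi_ae_eq_Ici).symm

theorem weightMeasure_Ici_ne_zero {w : ℝ → ℝ} (hw : ∀ x : ℝ, 0 < x → 0 < tail w x) (x : ℝ) :
    weightMeasure w (Ici x) ≠ 0 := by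
  have h : 0 < max x 1 := lt_max_of_lt_right one_pos
  have h1 := hw _ h
  rw [← weightMeasure_Ici w h] at h1
  exact (h1.trans_le (measure_mono (Ici_subset_Ici.2 (le_max_left x 1)))).ne'

/-- The function `u^p`, extended by zero to the non-positive half-line. -/
noncomputable def powWeight (p : ℝ) (u : ℝ → ℝ) : ℝ → ℝ≥0∞ :=
  (Ioi 0).indicator fun t => ENNReal.ofReal (u t) ^ p

theorem hull_eq_biSup_Ioc {f g : ℝ → ℝ≥0∞} (h0 : ∀ s ≤ 0, f s = 0) (h : ∀ s, 0 < s → f s = g s)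
    (t : ℝ) : hull f t = ⨆ s ∈ Ioc 0 t, g s := by
  refine le_antisymm (iSup₂_le fun s hs => ?_) (iSup₂_le fun s hs => ?_)
  · rcases le_or_gt s 0 with hs0 | hs0
    · rw [h0 s hs0]
      exact bot_le
    · rw [h s hs0]
      exact le_iSup₂_of_le s ⟨hs0, hs⟩ le_rfl
  · rw [← h s hs.1]
    exact le_hull f hs.2

theorem hull_powWeight_div (p : ℝ) (u v : ℝ → ℝ) :
    hull (fun s => powWeight p u s / weightMeasure v (Ici s) ^ 2) = supRatio p u v := by
  funext t
  refine hull_eq_biSup_Ioc (fun s hs => ?_) (fun s hs => ?_) t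
  · rw [powWeight, indicator_of_notMem (by simpa using hs), ENNReal.zero_div]
  · rw [powWeight, indicator_of_mem (show s ∈ Ioi 0 from hs), weightMeasure_Ici v hs]

theorem supRatio_of_nonpos (p : ℝ) (u v : ℝ → ℝ) {t : ℝ} (ht : t ≤ 0) : supRatio p u v t = 0 := by
  simp [supRatio, Ioc_eq_empty ht.not_gt]

theorem hull_supRatio_mul (p : ℝ) (u v : ℝ → ℝ) (x : ℝ) :
    hull (fun t => supRatio p u v t * weightMeasure v (Ici t)) x =
      ⨆ t ∈ Ioc (0 : ℝ) x, supRatio p u v t * tail v t := by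
  refine hull_eq_biSup_Ioc (fun s hs => ?_) (fun s hs => ?_) x
  · rw [supRatio_of_nonpos p u v hs, zero_mul]
  · rw [weightMeasure_Ici v hs]

theorem weightMeasure_Ici_ne_top {p : ℝ} {u v : ℝ → ℝ} (hv : ∀ x : ℝ, 0 < x → tail v x < ∞) (x : ℝ)
    (h : powWeight p u x ≠ 0) : weightMeasure v (Ici x) ≠ ∞ := by
  have hx : 0 < x := mem_of_indicator_ne_zero h
  rw [weightMeasure_Ici v hx]
  exact (hv x hx).ne

theorem withDensity_supRatio_Iic {p α : ℝ} {u v w : ℝ → ℝ} (hw : IsWeight w) (x : ℝ) :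
    (weightMeasure w).withDensity (fun t => supRatio p u v t ^ α) (Iic x) =
      ∫⁻ t in Ioc (0 : ℝ) x, supRatio p u v t ^ α * ENNReal.ofReal (w t) := by
  rw [withDensity_apply _ measurableSet_Iic, setLIntegral_weightMeasure hw measurableSet_Iic,
    inter_comm, Ioi_inter_Iic]

theorem le_supOp {f u : ℝ → ℝ≥0∞} (hf : MonotoneOn f (Ioi 0)) (hu : ContinuousOn u (Ioi 0))
    {s t : ℝ} (hs : 0 < s) (hst : s < t) : f s * u s ≤ supOp (fun τ => f τ * u τ) t := by
  refine le_of_forall_lt fun a ha => ?_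
  by_contra hlt
  obtain ⟨b, hab, hb⟩ := exists_between ha
  have hae : ∀ᵐ τ ∂volume.restrict (Ioc 0 t), f τ * u τ < b :=
    ae_lt_of_essSup_lt ((not_lt.1 hlt).trans_lt hab)
  have hcont : Filter.Tendsto (fun τ => f s * u τ) (nhdsWithin s (Ioi s)) (nhds (f s * u s)) := by
    refine ENNReal.Tendsto.const_mul
      (((hu.continuousAt (Ioi_mem_nhds hs)).tendsto).mono_left nhdsWithin_le_nhds) (Or.inl ?_)
    intro h0
    rw [h0, mul_zero] at hb
    exact not_lt_bot hb
  have hev := (hcont.eventually (lt_mem_nhds hb)).and (Ioo_mem_nhdsGT hst)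
  obtain ⟨d, hd, hsub⟩ := mem_nhdsGT_iff_exists_Ioo_subset.1 hev
  have hsub' : Ioo s d ⊆ Ioc 0 t := fun τ hτ => ⟨hs.trans hτ.1, (hsub hτ).2.2.le⟩
  have hfalse : ∀ᵐ τ ∂volume.restrict (Ioo s d), False := by
    filter_upwards [ae_restrict_of_ae_restrict_of_subset hsub' hae,
      ae_restrict_mem measurableSet_Ioo] with τ h1 h2
    have h3 : b < f s * u τ := (hsub h2).1
    have h4 : f s ≤ f τ := hf hs (hs.trans h2.1) h2.1.le
    exact (h3.trans_le (by gcongr)).not_gt h1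
  rw [ae_iff] at hfalse
  have hsd : s < d := hd
  simp [hsd.not_ge] at hfalse

theorem supOp_le (f : ℝ → ℝ≥0∞) (t : ℝ) : supOp f t ≤ ⨆ τ ∈ Ioc 0 t, f τ :=
  essSup_le_of_ae_le _ (by
    filter_upwards [ae_restrict_mem measurableSet_Ioc] with τ hτ
    exact le_iSup₂_of_le τ hτ le_rfl)

theorem wNorm_rpow {p : ℝ} (hp : 0 < p) {v : ℝ → ℝ} (hv : IsWeight v) (f : ℝ → ℝ≥0∞) :
    wNorm p v f ^ p = ∫⁻ t, f t ^ p ∂weightMeasure v := by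
  rw [wNorm, ← ENNReal.rpow_mul, one_div, inv_mul_cancel₀ hp.ne', ENNReal.rpow_one,
    lintegral_weightMeasure hv]

theorem lintegral_openHull_le {p q : ℝ} (hp : 0 < p) (hq : 0 < q) {u v w : ℝ → ℝ}
    (hu : ContinuousOn u (Ioi 0)) (hv : IsWeight v) (hw : IsWeight w)
    {c : ℝ≥0∞} (hc : HoldsWith p q u v w c) (g : ℝ → ℝ≥0∞) (hg : Monotone g) :
    ∫⁻ t, openHull (fun s => powWeight p u s * g s) t ^ (q / p) ∂weightMeasure w ≤
      c ^ q * (∫⁻ t, g t ∂weightMeasure v) ^ (q / p) := by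
  have hp' : p⁻¹ * p = 1 := inv_mul_cancel₀ hp.ne'
  have hfm : Monotone fun t => g t ^ p⁻¹ := fun s t h => by
    have := hg h
    dsimp only
    gcongr
  have h1 := hc (fun t => g t ^ p⁻¹) (hfm.monotoneOn _)
  have h2 := ENNReal.rpow_le_rpow h1 hq.le
  rw [ENNReal.mul_rpow_of_nonneg _ _ hq.le, wNorm_rpow hq hw,
    show q = p * (q / p) by field_simp, ENNReal.rpow_mul (wNorm _ _ _), wNorm_rpow hp hv,
    show p * (q / p) = q by field_simp] at h2
  simp only [← ENNReal.rpow_mul, hp', ENNReal.rpow_one] at h2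
  refine le_trans (lintegral_mono fun t => ?_) h2
  have h3 : openHull (fun s => powWeight p u s * g s) t ≤
      supOpW u (fun t => g t ^ p⁻¹) t ^ p := by
    refine iSup₂_le fun s (hs : s < t) => ?_
    dsimp only
    rcases le_or_gt s 0 with hs0 | hs0
    · rw [powWeight, indicator_of_notMem (by simpa using hs0), zero_mul]
      exact bot_le
    · rw [powWeight, indicator_of_mem (show s ∈ Ioi 0 from hs0)]
      calc ENNReal.ofReal (u s) ^ p * g s = (g s ^ p⁻¹ * ENNReal.ofReal (u s)) ^ p := by
            rw [ENNReal.mul_rpow_of_nonneg _ _ hp.le, ← ENNReal.rpow_mul, hp', ENNReal.rpow_one,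
              mul_comm]
        _ ≤ _ := by
            gcongr
            exact le_supOp (f := fun t => g t ^ p⁻¹) (hfm.monotoneOn _)
              (ENNReal.continuous_ofReal.comp_continuousOn hu) hs0 hs
  calc _ ≤ (supOpW u (fun t => g t ^ p⁻¹) t ^ p) ^ (q / p) := by gcongr
    _ = _ := by
      rw [← ENNReal.rpow_mul]
      congr 1
      field_simp

theorem holdsWith_of_lintegral_hull_le {p q : ℝ} (hp : 0 < p) (hq : 0 < q) {u v w : ℝ → ℝ}
    (hv : IsWeight v) (hw : IsWeight w) {c : ℝ≥0∞}
    (h : ∀ g : ℝ → ℝ≥0∞, Monotone g →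
      ∫⁻ t, hull (fun s => powWeight p u s * g s) t ^ (q / p) ∂weightMeasure w ≤
        c ^ q * (∫⁻ t, g t ∂weightMeasure v) ^ (q / p)) : HoldsWith p q u v w c := by
  intro f hf
  set g : ℝ → ℝ≥0∞ := (Ioi 0).indicator fun t => f t ^ p with hg
  have hgm : Monotone g := by
    intro s t hst
    by_cases hs : s ∈ Ioi 0
    · have ht : t ∈ Ioi 0 := lt_of_lt_of_le hs hst
      rw [hg, indicator_of_mem hs, indicator_of_mem ht]
      have := hf hs ht hst
      gcongr
    · rw [hg, indicator_of_notMem hs]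
      exact bot_le
  have hgint : ∫⁻ t, g t ∂weightMeasure v = wNorm p v f ^ p := by
    rw [wNorm_rpow hp hv, lintegral_weightMeasure hv, lintegral_weightMeasure hv]
    refine setLIntegral_congr_fun measurableSet_Ioi fun t ht => ?_
    simp only [hg, indicator_of_mem ht]
  have h1 := h g hgm
  rw [hgint, ← ENNReal.rpow_mul, show p * (q / p) = q by field_simp,
    ← ENNReal.mul_rpow_of_nonneg _ _ hq.le] at h1
  refine (ENNReal.rpow_le_rpow_iff hq).1 (le_trans ?_ h1)
  rw [wNorm_rpow hq hw]
  refine lintegral_mono fun t => ?_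
  have h2 : hull (fun s => powWeight p u s * g s) t =
      (⨆ s ∈ Ioc 0 t, f s * ENNReal.ofReal (u s)) ^ p := by
    rw [iSup₂_rpow _ _ hp]
    refine hull_eq_biSup_Ioc (fun s hs => ?_) (fun s hs => ?_) t
    · rw [powWeight, indicator_of_notMem (by simpa using hs), zero_mul]
    · rw [powWeight, hg, indicator_of_mem (show s ∈ Ioi 0 from hs),
        indicator_of_mem (show s ∈ Ioi 0 from hs), ENNReal.mul_rpow_of_nonneg _ _ hp.le, mul_comm]
  rw [h2, ← ENNReal.rpow_mul, show p * (q / p) = q by field_simp]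
  gcongr
  exact supOp_le _ t

theorem testTerm_le {p q : ℝ} {u v w : ℝ → ℝ} {c : ℝ≥0∞} (hc : HoldsWith p q u v w c) :
    testTerm p q u v w ≤ c :=
  ENNReal.div_le_of_le_mul (hc _ (monotoneOn_const))

theorem holdsWith_mono {p q : ℝ} {u v w : ℝ → ℝ} {c d : ℝ≥0∞} (hcd : c ≤ d)
    (hc : HoldsWith p q u v w c) : HoldsWith p q u v w d := fun f hf =>
  (hc f hf).trans (by gcongr)

theorem bestConst_equiv {p q : ℝ} {u v w : ℝ → ℝ} {Q : ℝ≥0∞} {C K : ℝ≥0}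
    (hl : ∀ c : ℝ≥0∞, c ≠ ∞ → HoldsWith p q u v w c → Q ≤ C * c)
    (hu : Q ≠ ∞ → HoldsWith p q u v w (K * Q)) :
    ((∃ c : ℝ≥0, HoldsWith p q u v w c) ↔ Q + testTerm p q u v w < ∞) ∧
    ((C + 1)⁻¹ : ℝ≥0) * (Q + testTerm p q u v w) ≤ bestConst p q u v w ∧
    bestConst p q u v w ≤ ((K + 1 : ℝ≥0) : ℝ≥0∞) * (Q + testTerm p q u v w) := by
  have hlow : ∀ c : ℝ≥0∞, c ≠ ∞ → HoldsWith p q u v w c →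
      Q + testTerm p q u v w ≤ ((C + 1 : ℝ≥0) : ℝ≥0∞) * c := by
    intro c hc h
    rw [ENNReal.coe_add, ENNReal.coe_one, add_mul, one_mul]
    exact add_le_add (hl c hc h) (testTerm_le h)
  have hup : Q ≠ ∞ → HoldsWith p q u v w (((K + 1 : ℝ≥0) : ℝ≥0∞) * (Q + testTerm p q u v w)) :=
    fun hQ => holdsWith_mono (by gcongr; exacts [by simp, le_self_add]) (hu hQ)
  refine ⟨⟨fun ⟨c, hc⟩ => ?_, fun h => ?_⟩, ?_, ?_⟩
  · exact (hlow c ENNReal.coe_ne_top hc).trans_lt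
      (ENNReal.mul_lt_top ENNReal.coe_lt_top ENNReal.coe_lt_top)
  · have hfin := ENNReal.mul_ne_top (ENNReal.coe_ne_top (r := K + 1)) h.ne
    refine ⟨(((K + 1 : ℝ≥0) : ℝ≥0∞) * (Q + testTerm p q u v w)).toNNReal, ?_⟩
    rw [ENNReal.coe_toNNReal hfin]
    exact hup (ne_top_of_le_ne_top h.ne le_self_add)
  · refine le_sInf fun c hc => ?_
    by_cases htop : c = ∞
    · rw [htop]; exact le_top
    rw [ENNReal.coe_inv (by positivity), mul_comm, ← div_eq_mul_inv]
    exact ENNReal.div_le_of_le_mul' (hlow c htop hc)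
  · by_cases hQ : Q = ∞
    · rw [hQ, top_add, ENNReal.mul_top (by simp)]
      exact le_top
    · exact sInf_le (hup hQ)

section Main

variable {p q : ℝ} {u v w : ℝ → ℝ}

theorem A₁_le (hp : 0 < p) (hq : 0 < q) (hu : ContinuousOn u (Ioi 0)) (hv : IsWeight v)
    (hw : IsWeight w) (hV : ∀ x : ℝ, 0 < x → 0 < tail v x ∧ tail v x < ∞) {c : ℝ≥0∞}
    (hc : HoldsWith p q u v w c) : A₁ p q u v w ≤ (1 + 4 ^ (q / p)) ^ (1 / q) * c := by
  have hα : 0 < q / p := by positivity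
  refine iSup₂_le fun x (hx : 0 < x) => ?_
  have h := hull_rpow_mul_add_le hα (weightMeasure_Ici_ne_zero fun x hx => (hV x hx).1)
    (weightMeasure_Ici_ne_top fun x hx => (hV x hx).2) (lintegral_openHull_le hp hq hu hv hw hc) x
  rw [hull_powWeight_div, withDensity_supRatio_Iic hw, weightMeasure_Ici v hx,
    weightMeasure_Ici w hx] at h
  have h2 := ENNReal.rpow_le_rpow h (show 0 ≤ 1 / q by positivity)
  rw [ENNReal.mul_rpow_of_nonneg _ _ (show 0 ≤ 1 / q by positivity),
    ENNReal.mul_rpow_of_nonneg _ _ (show 0 ≤ 1 / q by positivity), ← ENNReal.rpow_mul (tail v x),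
    ← ENNReal.rpow_mul c, show q / p * (1 / q) = 1 / p by field_simp,
    show q * (1 / q) = 1 by field_simp, ENNReal.rpow_one] at h2
  exact h2

theorem holdsWith_A₁ (hp : 0 < p) (hq : 0 < q) (hpq : p ≤ q) (hv : IsWeight v)
    (hw : IsWeight w) (hV : ∀ x : ℝ, 0 < x → 0 < tail v x ∧ tail v x < ∞) :
    HoldsWith p q u v w ((4 ^ (q / p) * 2 * 2 ^ (q / p)) ^ (1 / q) * A₁ p q u v w) := by
  have hα : 1 ≤ q / p := (one_le_div hp).2 hpq
  have hα0 : 0 ≤ q / p := by linarith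
  refine holdsWith_of_lintegral_hull_le hp hq hv hw fun g hg => ?_
  refine (lintegral_hull_mul_rpow_le_of_one_le hα
    (weightMeasure_Ici_ne_zero fun x hx => (hV x hx).1)
    (weightMeasure_Ici_ne_top fun x hx => (hV x hx).2) hg (A := A₁ p q u v w ^ q) fun x => ?_).trans_eq ?_
  · rw [hull_powWeight_div, withDensity_supRatio_Iic hw]
    rcases le_or_gt x 0 with hx | hx
    · rw [supRatio_of_nonpos p u v hx, ENNReal.zero_rpow_of_pos (by linarith),
        Ioc_eq_empty hx.not_gt]
      simp
    · rw [weightMeasure_Ici v hx, weightMeasure_Ici w hx]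
      have h : _ ≤ A₁ p q u v w := le_iSup₂_of_le x hx le_rfl
      have h2 := ENNReal.rpow_le_rpow h hq.le
      rwa [ENNReal.mul_rpow_of_nonneg _ _ hq.le, ← ENNReal.rpow_mul, ← ENNReal.rpow_mul,
        show 1 / q * q = 1 by field_simp, show 1 / p * q = q / p by ring, ENNReal.rpow_one] at h2
  · rw [ENNReal.mul_rpow_of_nonneg _ _ hα0, ENNReal.mul_rpow_of_nonneg _ _ hq.le,
      ← ENNReal.rpow_mul _ (1 / q), show 1 / q * q = 1 by field_simp, ENNReal.rpow_one]
    ring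

theorem rExp_eq (hp : 0 < p) (hq : 0 < q) : rExp p q = p * q / (p - q) := by
  rw [rExp, div_sub_div _ _ hq.ne' hp.ne', inv_div]
  ring

theorem rExp_pos (hp : 0 < p) (hq : 0 < q) (hqp : q < p) : 0 < rExp p q := by
  rw [rExp_eq hp hq]
  have : 0 < p - q := by linarith
  positivity

theorem rExp_div (hp : 0 < p) (hq : 0 < q) : rExp p q / p = q / (p - q) := by
  rw [rExp_eq hp hq]
  field_simp

theorem B₁_eq (hp : 0 < p) (hq : 0 < q) (hw : IsWeight w) :
    B₁ p q u v w = (∫⁻ x, (weightMeasure w).withDensity (fun t =>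
        hull (fun s => powWeight p u s / weightMeasure v (Ici s) ^ 2) t ^ (q / p)) (Iic x)
          ^ (q / (p - q)) * weightMeasure v (Ici x) ^ (q / (p - q))
        ∂(weightMeasure w).withDensity (fun t =>
          hull (fun s => powWeight p u s / weightMeasure v (Ici s) ^ 2) t ^ (q / p)))
        ^ (1 / rExp p q) := by
  have hm := (monotone_hull fun s => powWeight p u s / weightMeasure v (Ici s) ^ 2).measurable
  have hm' : ∀ μ : Measure ℝ, Measurable fun x =>
      μ (Iic x) ^ (q / (p - q)) * weightMeasure v (Ici x) ^ (q / (p - q)) := fun μ =>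
    ((isRayFamily_Iic.measurable_measure μ).pow_const _).mul
      ((isRayFamily_Ici.measurable_measure _).pow_const _)
  rw [lintegral_withDensity_eq_lintegral_mul₀ (hm.pow_const _).aemeasurable
    (hm' _).aemeasurable,
    lintegral_weightMeasure hw, B₁, rExp_div hp hq]
  congr 1
  refine setLIntegral_congr_fun measurableSet_Ioi fun x hx => ?_
  simp only [Pi.mul_apply, hull_powWeight_div]
  rw [withDensity_supRatio_Iic hw, weightMeasure_Ici v hx]
  ring

theorem B₂_eq (hp : 0 < p) (hq : 0 < q) (hw : IsWeight w) :
    B₂ p q u v w = (∫⁻ x, weightMeasure w (Ici x) ^ (q / (p - q)) *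
      hull (fun t => hull (fun s => powWeight p u s / weightMeasure v (Ici s) ^ 2) t *
        weightMeasure v (Ici t)) x ^ (q / (p - q)) ∂weightMeasure w) ^ (1 / rExp p q) := by
  rw [lintegral_weightMeasure hw, B₂, rExp_div hp hq]
  congr 1
  refine setLIntegral_congr_fun measurableSet_Ioi fun x hx => ?_
  simp only [hull_powWeight_div, hull_supRatio_mul]
  rw [weightMeasure_Ici w hx]

/-- The constant in the lower bound of the best constant by `B₁ + B₂`. -/
noncomputable def necessityConst (p q : ℝ) : ℝ≥0∞ :=
  (2 ^ (q / (p - q)) * (lowerConst (q / (p - q)) * 4 ^ (q / p)) ^ (q / (p - q) + 1))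
      ^ (1 / rExp p q) +
    (2 ^ (q / (p - q)) * lowerConst (q / (p - q)) ^ (q / (p - q) + 1)) ^ (1 / rExp p q)

theorem lowerConst_ne_top {β : ℝ} (hβ : 0 < β) : lowerConst β ≠ ∞ :=
  ENNReal.mul_ne_top (by simp) (ENNReal.mul_ne_top (geomConst_ne_top hβ) (by simp))

theorem necessityConst_ne_top (hp : 0 < p) (hq : 0 < q) (hqp : q < p) :
    necessityConst p q ≠ ∞ := by
  have h : 0 < p - q := by linarith
  have hβ : 0 < q / (p - q) := by positivity
  have hr := rExp_pos hp hq hqp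
  have hl := lowerConst_ne_top hβ
  have h4 : (4 : ℝ≥0∞) ^ (q / p) ≠ ∞ := ENNReal.rpow_ne_top_of_nonneg (by positivity) (by simp)
  exact ENNReal.add_ne_top.2 ⟨ENNReal.rpow_ne_top_of_nonneg (by positivity)
      (ENNReal.mul_ne_top (by simp)
        (ENNReal.rpow_ne_top_of_nonneg (by positivity) (ENNReal.mul_ne_top hl h4))),
    ENNReal.rpow_ne_top_of_nonneg (by positivity)
      (ENNReal.mul_ne_top (by simp) (ENNReal.rpow_ne_top_of_nonneg (by positivity) hl))⟩

theorem B₁_add_B₂_le (hp : 0 < p) (hq : 0 < q) (hqp : q < p) (hu : ContinuousOn u (Ioi 0))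
    (hv : IsWeight v) (hw : IsWeight w) (hV : ∀ x : ℝ, 0 < x → 0 < tail v x ∧ tail v x < ∞)
    {c : ℝ≥0∞} (hctop : c ≠ ∞) (hc : HoldsWith p q u v w c) :
    B₁ p q u v w + B₂ p q u v w ≤ necessityConst p q * c := by
  have h : 0 < p - q := by linarith
  have hr := rExp_pos hp hq hqp
  have hr' : 0 ≤ 1 / rExp p q := by positivity
  have hα0 : 0 < q / p := by positivity
  have hα1 : q / p < 1 := (div_lt_one hp).2 hqp
  have hβ0 : 0 < q / (p - q) := by positivity
  have hβ : q / (p - q) * (1 - q / p) = q / p := by field_simp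
  have hV0 := weightMeasure_Ici_ne_zero fun x hx => (hV x hx).1
  have hUV := weightMeasure_Ici_ne_top (p := p) (u := u) fun x hx => (hV x hx).2
  have hD := ENNReal.rpow_ne_top_of_nonneg hq.le hctop
  have hexp : q * (q / (p - q) + 1) * (1 / rExp p q) = 1 := by
    rw [rExp_eq hp hq]
    field_simp
    ring
  have hlow := lintegral_openHull_le hp hq hu hv hw hc
  have h1 := lintegral_Iic_rpow_mul_le hα0 hα1 hβ0 hβ hV0 hD hlow
  have h2 := lintegral_Ici_rpow_mul_le hα0 hα1 hβ0 hβ hV0 hUV hD hlow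
  have key : ∀ C : ℝ≥0∞, (2 ^ (q / (p - q)) * (C * c ^ q) ^ (q / (p - q) + 1)) ^ (1 / rExp p q) =
      (2 ^ (q / (p - q)) * C ^ (q / (p - q) + 1)) ^ (1 / rExp p q) * c := by
    intro C
    rw [ENNReal.mul_rpow_of_nonneg C _ (by positivity), ← mul_assoc,
      ENNReal.mul_rpow_of_nonneg _ ((c ^ q) ^ _) hr', ← ENNReal.rpow_mul c, ← ENNReal.rpow_mul c,
      hexp, ENNReal.rpow_one]
  rw [B₁_eq hp hq hw, B₂_eq hp hq hw, necessityConst, add_mul, ← key, ← key]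
  rw [← mul_assoc (lowerConst _)] at h1
  gcongr

/-- The constant in the upper bound of the best constant by `B₁ + B₂`. -/
noncomputable def sufficiencyConst (p q : ℝ) : ℝ≥0∞ :=
  (4 ^ (q / p) * ((2 ^ (q / (p - q) + 1)) ^ (1 - q / p) + 2 ^ (q / p) *
    (2 ^ (q / (p - q) + 1) * geomConst (q / (p - q))) ^ (1 - q / p)) * 2 ^ (q / p)) ^ (1 / q)

theorem sufficiencyConst_ne_top (hp : 0 < p) (hq : 0 < q) (hqp : q < p) :
    sufficiencyConst p q ≠ ∞ := by
  have h : 0 < p - q := by linarith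
  have hβ : 0 < q / (p - q) := by positivity
  have hα1 : 0 ≤ 1 - q / p := by
    have := (div_lt_one hp).2 hqp
    linarith
  have h4 : (4 : ℝ≥0∞) ^ (q / p) ≠ ∞ := ENNReal.rpow_ne_top_of_nonneg (by positivity) (by simp)
  refine ENNReal.rpow_ne_top_of_nonneg (by positivity) (ENNReal.mul_ne_top (ENNReal.mul_ne_top h4
    (ENNReal.add_ne_top.2 ⟨ENNReal.rpow_ne_top_of_nonneg hα1 (two_rpow_ne_top _),
      ENNReal.mul_ne_top (two_rpow_ne_top _) (ENNReal.rpow_ne_top_of_nonneg hα1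
        (ENNReal.mul_ne_top (two_rpow_ne_top _) (geomConst_ne_top hβ)))⟩)) (two_rpow_ne_top _))

theorem holdsWith_B₁_add_B₂ (hp : 0 < p) (hq : 0 < q) (hqp : q < p) (hv : IsWeight v)
    (hw : IsWeight w) (hV : ∀ x : ℝ, 0 < x → 0 < tail v x ∧ tail v x < ∞)
    (hW : ∀ x : ℝ, 0 < x → 0 < tail w x ∧ tail w x < ∞)
    (hfin : B₁ p q u v w + B₂ p q u v w ≠ ∞) :
    HoldsWith p q u v w (sufficiencyConst p q * (B₁ p q u v w + B₂ p q u v w)) := by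
  have h : 0 < p - q := by linarith
  have hr := rExp_pos hp hq hqp
  have hα0 : 0 < q / p := by positivity
  have hα1 : q / p < 1 := (div_lt_one hp).2 hqp
  have hα1' : 0 ≤ 1 - q / p := by linarith
  have hβ0 : 0 < q / (p - q) := by positivity
  have hβ : q / (p - q) * (1 - q / p) = q / p := by field_simp
  refine holdsWith_of_lintegral_hull_le hp hq hv hw fun g hg => ?_
  set Q := B₁ p q u v w + B₂ p q u v w with hQ
  have hback : ∀ I J : ℝ≥0∞, J = I ^ (1 / rExp p q) → J ≤ Q → I ≤ Q ^ rExp p q := by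
    rintro I J rfl hJ
    rwa [one_div, ENNReal.rpow_inv_le_iff hr] at hJ
  refine (lintegral_hull_mul_rpow_le_of_lt_one hα0 hα1 hβ0 hβ
    (weightMeasure_Ici_ne_zero fun x hx => (hV x hx).1)
    (weightMeasure_Ici_ne_top fun x hx => (hV x hx).2)
    (weightMeasure_Ici_ne_zero fun x hx => (hW x hx).1) hg
    (hback _ _ (B₁_eq hp hq hw) le_self_add) (hback _ _ (B₂_eq hp hq hw) le_add_self)
    (ENNReal.rpow_ne_top_of_nonneg hr.le hfin)).trans_eq ?_
  have hexp : rExp p q * (1 - q / p) = q := by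
    rw [rExp_eq hp hq]
    field_simp
  rw [sufficiencyConst, ENNReal.mul_rpow_of_nonneg _ Q hq.le, ← ENNReal.rpow_mul _ (1 / q) q,
    show 1 / q * q = 1 by field_simp, ENNReal.rpow_one, ← mul_assoc _ (geomConst _),
    ENNReal.mul_rpow_of_nonneg _ (Q ^ rExp p q) hα1',
    ENNReal.mul_rpow_of_nonneg _ (Q ^ rExp p q) hα1', ← ENNReal.rpow_mul Q, hexp,
    ENNReal.mul_rpow_of_nonneg _ (∫⁻ x, g x ∂weightMeasure v) hα0.le]
  ring

end Main

end SupremalHardy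

theorem mainTheorem7 (p q : ℝ) (hp : 0 < p) (hq : 0 < q) :
    ∃ k K : ℝ≥0, 0 < k ∧ 0 < K ∧
      ∀ u v w : ℝ → ℝ, IsWeight u → ContinuousOn u (Ioi 0) → IsWeight v → IsWeight w →
        (∀ x : ℝ, 0 < x → 0 < tail v x ∧ tail v x < ∞) →
        (∀ x : ℝ, 0 < x → 0 < tail w x ∧ tail w x < ∞) →
        (p ≤ q →
          ((∃ c : ℝ≥0, HoldsWith p q u v w c) ↔ A₁ p q u v w + testTerm p q u v w < ∞) ∧
          k * (A₁ p q u v w + testTerm p q u v w) ≤ bestConst p q u v w ∧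
          bestConst p q u v w ≤ K * (A₁ p q u v w + testTerm p q u v w)) ∧
        (q < p →
          ((∃ c : ℝ≥0, HoldsWith p q u v w c) ↔
            B₁ p q u v w + B₂ p q u v w + testTerm p q u v w < ∞) ∧
          k * (B₁ p q u v w + B₂ p q u v w + testTerm p q u v w) ≤ bestConst p q u v w ∧
          bestConst p q u v w ≤ K * (B₁ p q u v w + B₂ p q u v w + testTerm p q u v w)) := by
  rcases le_or_gt p q with hpq | hqp
  · have h4 : (4 : ℝ≥0∞) ^ (q / p) ≠ ∞ := ENNReal.rpow_ne_top_of_nonneg (by positivity) (by simp)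
    obtain ⟨C, hC⟩ : ∃ C : ℝ≥0, (C : ℝ≥0∞) = (1 + 4 ^ (q / p)) ^ (1 / q) :=
      ⟨_, ENNReal.coe_toNNReal (ENNReal.rpow_ne_top_of_nonneg (by positivity)
        (ENNReal.add_ne_top.2 ⟨ENNReal.one_ne_top, h4⟩))⟩
    obtain ⟨K, hK⟩ : ∃ K : ℝ≥0, (K : ℝ≥0∞) = (4 ^ (q / p) * 2 * 2 ^ (q / p)) ^ (1 / q) :=
      ⟨_, ENNReal.coe_toNNReal (ENNReal.rpow_ne_top_of_nonneg (by positivity)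
        (ENNReal.mul_ne_top (ENNReal.mul_ne_top h4 (by simp)) (two_rpow_ne_top _)))⟩
    refine ⟨(C + 1)⁻¹, K + 1, by positivity, by positivity,
      fun u v w _ huc hv hw hV hW => ⟨fun _ => ?_, fun h => (h.not_ge hpq).elim⟩⟩
    exact bestConst_equiv (fun c _ hc => hC ▸ A₁_le hp hq huc hv hw hV hc)
      (fun _ => hK ▸ holdsWith_A₁ hp hq hpq hv hw hV)
  · refine ⟨((necessityConst p q).toNNReal + 1)⁻¹, (sufficiencyConst p q).toNNReal + 1,
      by positivity, by positivity,
      fun u v w _ huc hv hw hV hW => ⟨fun h => (h.not_gt hqp).elim, fun _ => ?_⟩⟩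
    refine bestConst_equiv (fun c hc' hc => ?_) (fun hfin => ?_)
    · rw [ENNReal.coe_toNNReal (necessityConst_ne_top hp hq hqp)]
      exact B₁_add_B₂_le hp hq hqp huc hv hw hV hc' hc
    · rw [ENNReal.coe_toNNReal (sufficiencyConst_ne_top hp hq hqp)]
      exact holdsWith_B₁_add_B₂ hp hq hqp hv hw hV hW hfin
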